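/- **Theorem (almost sure CGMT).** For each $n$ let $p=p(n)$, let $\mathcal S_{\mathbf w}=\mathcal S_{\mathbf w}^{(n)}\subset\mathbb R^{p}$ and $\mathcal S_{\mathbf u}=\mathcal S_{\mathbf u}^{(n)}\subset\mathbb R^{n}$ be compact convex sets, and let $\psi^{(n)}:\mathbb R^p\times\mathbb R^n\to\mathbb R$ be a (possibly random) function that is continuous on $\mathcal S_{\mathbf w}\times\mathcal S_{\mathbf u}$, convex in $\mathbf w\in\mathcal S_{\mathbf w}$ and concave in $\mathbf u\in\mathcal S_{\mathbf u}$. Let $\mathbf G^{(n)}\in\mathbb R^{n\times p}$ have i.i.d. standard normal entries, and let $\mathbf g^{(n)}\in\mathbb R^n$, $\mathbf h^{(n)}\in\mathbb R^p$ be independent standard Gaussian vectors, the pairs $(\mathbf g^{(n)},\mathbf h^{(n)})$ being independent over $n$. Assume that the sequence $(\psi^{(m)})_m$ is independent of $\mathbf G^{(n)}$ for each $n$, and independent of the sequence $(\mathbf g^{(n)},\mathbf h^{(n)})_n$. Consider the primary problem $$\Phi^{(n)}=\min_{\mathbf w\in\mathcal S_{\mathbf w}}\max_{\mathbf u\in\mathcal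 S_{\mathbf u}}\ \mathbf u^T\mathbf G^{(n)}\mathbf w+\psi^{(n)}(\mathbf w,\mathbf u)$$ and, for $A\subset\mathcal S_{\mathbf w}$, the auxiliary optimal cost $$\phi^{(n)}_{A}=\min_{\mathbf w\in A}\max_{\mathbf u\in\mathcal S_{\mathbf u}}\ \|\mathbf w\|_2\,\mathbf g^{(n)T}\mathbf u+\|\mathbf u\|_2\,\mathbf h^{(n)T}\mathbf w+\psi^{(n)}(\mathbf w,\mathbf u)$$ (with the convention that a minimum over the empty set is $+\infty$ and a maximum over it is $-\infty$). Write $\phi^{(n)}=\phi^{(n)}_{\mathcal S_{\mathbf w}}$. Let $\mathcal S=\mathcal S^{(n)}$ be a relatively open subset of $\mathcal S_{\mathbf w}$ and $\mathcal S^c=\mathcal S_{\mathbf w}\setminus\mathcal S$. Suppose there are real constants $\overline\phi<\overline\phi_{\mathcal S^c}$ such that $\phi^{(n)}\to\overline\phi$ almost surely and $\phi^{(n)}_{\mathcal S^c}\to\overline\phi_{\mathcal S^c}$ almost surely. Then, almost surely, for all sufficiently large $n$ every minimizer $\mathbf w_\Phi$ of the primary problem belongs to $\mathcal S^{(n)}$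 (so, in particular, $\mathbf w_\Phi\in\mathcal S$ infinitely often with probability one). -/

import Mathlib

open MeasureTheory ProbabilityTheory Filter Topology Matrix

/-- The family `X` consists of i.i.d. standard normal real random variables. -/
def IsStdGaussianFamily {Ω ι : Type*} [MeasurableSpace Ω] (μ : Measure Ω) (X : ι → Ω → ℝ) : Prop :=
  (∀ i, Measurable (X i)) ∧ (∀ i, μ.map (X i) = gaussianReal 0 1) ∧ iIndepFun X μ

/-- The min-max value `min_{w ∈ A} max_{u ∈ B} f w u`, as an extended real
(so it is `+∞` when `A` is empty, and `-∞` when `A` is nonempty and `B` is empty). -/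
noncomputable def minMax {E F : Type*} (A : Set E) (B : Set F) (f : E → F → ℝ) : EReal :=
  ⨅ w ∈ A, ⨆ u ∈ B, (f w u : EReal)

/-- `w` solves the outer problem of `min_{w ∈ A} max_{u ∈ B} f w u`. -/
def IsMinMaxMinimizer {E F : Type*} (A : Set E) (B : Set F) (f : E → F → ℝ) (w : E) : Prop :=
  w ∈ A ∧ ∀ w' ∈ A, (⨆ u ∈ B, (f w u : EReal)) ≤ ⨆ u ∈ B, (f w' u : EReal)

/-- Primary objective `uᵀ G w + ψ(w, u)`. -/
noncomputable def primaryObjective {n p : ℕ} (G : Matrix (Fin n) (Fin p) ℝ)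
    (ψ : EuclideanSpace ℝ (Fin p) → EuclideanSpace ℝ (Fin n) → ℝ)
    (w : EuclideanSpace ℝ (Fin p)) (u : EuclideanSpace ℝ (Fin n)) : ℝ :=
  u.ofLp ⬝ᵥ (G *ᵥ w.ofLp) + ψ w u

/-- Auxiliary objective `‖w‖₂ gᵀ u + ‖u‖₂ hᵀ w + ψ(w, u)`. -/
noncomputable def auxObjective {n p : ℕ}
    (g : EuclideanSpace ℝ (Fin n)) (h : EuclideanSpace ℝ (Fin p))
    (ψ : EuclideanSpace ℝ (Fin p) → EuclideanSpace ℝ (Fin n) → ℝ)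
    (w : EuclideanSpace ℝ (Fin p)) (u : EuclideanSpace ℝ (Fin n)) : ℝ :=
  ‖w‖ * inner ℝ g u + ‖u‖ * inner ℝ h w + ψ w u

/-!
Almost sure convex Gaussian min-max theorem.

For a fixed continuous `ψ`, Gordon's inequality compares the process `uᵀ G w + ‖u‖ ‖w‖ z` with the
auxiliary process `‖w‖ gᵀ u + ‖u‖ hᵀ w`: variances and covariances for equal `w` agree, and
covariances for distinct `w` are at least as large for the first process. Conditioning on
`z ≤ 0` removes the extra term at the price of a factor `2`, so that
`P(Φ < t) ≤ 2 P(φ ≤ t)` (`measure_minMax_primary_lt_le`). When the sets are convex and `ψ` is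
convex-concave, Sion's theorem writes `Φ` as a max-min, and the same bound for the game with players
exchanged gives `P(Φ > t) ≤ 2 P(φ ≥ t)` (`measure_lt_minMax_primary_le`). Gordon's inequality itself
(`gordon_comparison`) is proved by interpolating between the two Gaussian arrays
(`gaussian_interpolation`) along a smooth product test function.

The random `ψ` is handled by conditioning on the whole sequence of the `ψ`'s. Given it, the
auxiliary values are independent over `n`, so their almost sure convergence forces the probabilities of
`φ ≥ c₁` and of `φ_{Sᶜ} ≤ c₂` to be summable, for any `φbar < c₁ < c₂ < φbarSc`, by the converse
Borel-Cantelli lemma. The two comparison bounds carry summability over to `Φ > c₁` and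
`Φ_{Sᶜ} < c₂`, and the direct Borel-Cantelli lemma, which needs no independence over `n` of the
matrices `G`, shows that eventually `Φ ≤ c₁ < c₂ ≤ Φ_{Sᶜ}`
(`ae_eventually_notMem_of_measure_le_two_mul`). A minimizer outside `S` would give
`Φ_{Sᶜ} ≤ Φ`. Measurability of all these values in the random data comes from replacing the feasible
sets by countable dense subsets (`minMax_eq_of_subset_closure`).
-/

/-! ### Gaussian integration by parts -/

/-- Gaussian integration by parts on the line. -/
theorem integral_id_mul_gaussianReal {f f' : ℝ → ℝ} {C : ℝ}
    (hf : ∀ x, HasDerivAt f (f' x) x) (hC : ∀ x, |f x| ≤ C) (hC' : ∀ x, |f' x| ≤ C) :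
    ∫ x, x * f x ∂gaussianReal 0 1 = ∫ x, f' x ∂gaussianReal 0 1 := by
  have hfm : Measurable f :=
    (continuous_iff_continuousAt.2 fun x => (hf x).continuousAt).measurable
  have hf'm : Measurable f' := by
    rw [show f' = deriv f from funext fun x => ((hf x).deriv).symm]
    exact measurable_deriv f
  have hid : Integrable (fun x : ℝ => x) (gaussianReal 0 1) :=
    (memLp_id_gaussianReal 1).integrable le_rfl
  have h1 : Integrable (fun x => x * f x) (gaussianReal 0 1) :=
    hid.mul_bdd hfm.aestronglyMeasurable (Eventually.of_forall hC)
  have h2 : Integrable f' (gaussianReal 0 1) :=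
    Integrable.of_bound hf'm.aestronglyMeasurable C (Eventually.of_forall hC')
  have h3 : Integrable f (gaussianReal 0 1) :=
    Integrable.of_bound hfm.aestronglyMeasurable C (Eventually.of_forall hC)
  have key : ∀ {k : ℝ → ℝ}, Integrable k (gaussianReal 0 1) →
      Integrable (fun x => gaussianPDFReal 0 1 x * k x) := by
    intro k hk
    rw [gaussianReal_of_var_ne_zero _ one_ne_zero] at hk
    rw [integrable_withDensity_iff_integrable_smul' (measurable_gaussianPDF 0 1)
      (Eventually.of_forall fun _ => gaussianPDF_lt_top)] at hk
    simpa [toReal_gaussianPDF] using hk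
  -- the density solves `ρ' = -x ρ`, and `(ρ f)'` integrates to zero
  have hp : ∀ x, HasDerivAt (gaussianPDFReal 0 1) (-x * gaussianPDFReal 0 1 x) x := by
    intro x
    have : HasDerivAt (fun x : ℝ => (√(2 * Real.pi * 1))⁻¹ * Real.exp (-(x - 0) ^ 2 / (2 * 1)))
        ((√(2 * Real.pi * 1))⁻¹ * (Real.exp (-(x - 0) ^ 2 / (2 * 1)) * (-x))) x := by
      refine (HasDerivAt.exp ?_).const_mul _
      have := ((((hasDerivAt_id x).sub_const 0).pow 2).neg.div_const (2 * 1))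
      refine this.congr_deriv ?_
      simp
      ring
    refine this.congr_deriv ?_
    simp [gaussianPDFReal]
    ring
  have h0 := integral_eq_zero_of_hasDerivAt_of_integrable
    (f := fun x => gaussianPDFReal 0 1 x * f x)
    (f' := fun x => gaussianPDFReal 0 1 x * f' x - gaussianPDFReal 0 1 x * (x * f x))
    (fun x => ((hp x).mul (hf x)).congr_deriv (by ring))
    ((key h2).sub (key h1)) (key h3)
  rw [integral_sub (key h2) (key h1)] at h0
  rw [integral_gaussianReal_eq_integral_smul one_ne_zero,
    integral_gaussianReal_eq_integral_smul one_ne_zero]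
  simp only [smul_eq_mul]
  linarith

/-- The standard Gaussian measure on `ι → ℝ`. -/
noncomputable abbrev stdGaussianPi (ι : Type*) [Fintype ι] : Measure (ι → ℝ) :=
  Measure.pi fun _ => gaussianReal 0 1

/-- Resampling one coordinate of a product probability measure preserves it. -/
theorem measurePreserving_update_pi {ι : Type*} [Fintype ι] [DecidableEq ι] {X : ι → Type*}
    [∀ i, MeasurableSpace (X i)] (ν : ∀ i, Measure (X i)) [∀ i, IsProbabilityMeasure (ν i)]
    (m : ι) :
    MeasurePreserving (fun z : (∀ i, X i) × X m => Function.update z.1 m z.2)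
      ((Measure.pi ν).prod (ν m)) (Measure.pi ν) := by
  have hmeas : Measurable (fun z : (∀ i, X i) × X m => Function.update z.1 m z.2) := by
    refine measurable_pi_lambda _ fun i => ?_
    by_cases hi : i = m
    · subst hi; simpa using measurable_snd
    · simp only [Function.update_of_ne hi]
      exact (measurable_pi_apply i).comp measurable_fst
  refine ⟨hmeas, (Measure.pi_eq fun s hs => ?_).symm⟩
  rw [Measure.map_apply hmeas (MeasurableSet.univ_pi hs)]
  have : (fun z : (∀ i, X i) × X m => Function.update z.1 m z.2) ⁻¹' Set.univ.pi s
      = Set.univ.pi (Function.update s m Set.univ) ×ˢ s m := by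
    ext ⟨x, t⟩
    simp only [Set.mem_preimage, Set.mem_pi, Set.mem_univ, true_imp_iff, Set.mem_prod]
    constructor
    · intro h
      refine ⟨fun i => ?_, by simpa using h m⟩
      by_cases hi : i = m
      · subst hi; simp
      · simpa [hi] using h i
    · rintro ⟨h, ht⟩ i
      by_cases hi : i = m
      · subst hi; simpa using ht
      · simpa [hi] using h i
  rw [this, Measure.prod_prod, Measure.pi_pi, ← Finset.mul_prod_erase _ _ (Finset.mem_univ m),
    ← Finset.mul_prod_erase (a := m) _ _ (Finset.mem_univ m)]
  simp only [Function.update_self, measure_univ, one_mul]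
  rw [mul_comm]
  congr 1
  refine Finset.prod_congr rfl fun i hi => ?_
  rw [Function.update_of_ne (Finset.ne_of_mem_erase hi)]

theorem integrable_eval_stdGaussianPi {ι : Type*} [Fintype ι] (m : ι) :
    Integrable (fun x : ι → ℝ => x m) (stdGaussianPi ι) :=
  (measurePreserving_eval (fun _ : ι => gaussianReal 0 1) m).integrable_comp_of_integrable
    (g := fun x : ℝ => x) ((memLp_id_gaussianReal 1).integrable le_rfl)

/-- Gaussian integration by parts in the coordinate `m`. -/
theorem integral_eval_mul_stdGaussianPi {ι : Type*} [Fintype ι] [DecidableEq ι] (m : ι)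
    {F F' : (ι → ℝ) → ℝ} {C : ℝ} (hF : Measurable F) (hF' : Measurable F')
    (hd : ∀ x, HasDerivAt (fun t => F (Function.update x m t)) (F' x) (x m))
    (hC : ∀ x, |F x| ≤ C) (hC' : ∀ x, |F' x| ≤ C) :
    ∫ x, x m * F x ∂stdGaussianPi ι = ∫ x, F' x ∂stdGaussianPi ι := by
  have hmp : MeasurePreserving (fun z : (ι → ℝ) × ℝ => Function.update z.1 m z.2)
      ((stdGaussianPi ι).prod (gaussianReal 0 1)) (stdGaussianPi ι) :=
    measurePreserving_update_pi (fun _ : ι => gaussianReal 0 1) m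
  have h1 : Integrable (fun x : ι → ℝ => x m * F x) (stdGaussianPi ι) :=
    (integrable_eval_stdGaussianPi m).mul_bdd hF.aestronglyMeasurable (Eventually.of_forall hC)
  have h2 : Integrable F' (stdGaussianPi ι) :=
    Integrable.of_bound hF'.aestronglyMeasurable C (Eventually.of_forall hC')
  have e : ∀ {k : (ι → ℝ) → ℝ}, Integrable k (stdGaussianPi ι) →
      ∫ x, k x ∂stdGaussianPi ι
        = ∫ x, ∫ t, k (Function.update x m t) ∂gaussianReal 0 1 ∂stdGaussianPi ι := by
    intro k hk
    have h := integral_map hmp.measurable.aemeasurable (f := k)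
      (by rw [hmp.map_eq]; exact hk.aestronglyMeasurable)
    rw [hmp.map_eq] at h
    exact h.trans (integral_prod _ (hmp.integrable_comp_of_integrable hk))
  rw [e h1, e h2]
  congr 1 with x
  simp only [Function.update_self]
  refine integral_id_mul_gaussianReal (C := C) (fun t => ?_) (fun _ => hC _) fun _ => hC' _
  simpa using hd (Function.update x m t)

/-! ### Gaussian interpolation -/

/-- Gaussian interpolation. For `X = A ξ` and `Y = B ξ` with `ξ` standard Gaussian and orthogonal
`A`, `B`, the derivative of `E f (sin θ • X + cos θ • Y)` in `θ` is, by integration by parts,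
`sin θ * cos θ * ∑ a b, (Cov X - Cov Y) a b * E (f'' a b)`, so it is nonnegative on `[0, π / 2]` if
every summand is. -/
theorem gaussian_interpolation {α M : Type*} [Fintype α] [Fintype M]
    (A B : α → M → ℝ) (hAB : ∀ a b, ∑ m, A a m * B b m = 0)
    {f : (α → ℝ) → ℝ} {f' : α → (α → ℝ) → ℝ} {f'' : α → α → (α → ℝ) → ℝ} {C : ℝ}
    (hf : ∀ x, HasFDerivAt f
      (∑ a, f' a x • (ContinuousLinearMap.proj a : (α → ℝ) →L[ℝ] ℝ)) x)
    (hf' : ∀ a x, HasFDerivAt (f' a)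
      (∑ b, f'' a b x • (ContinuousLinearMap.proj b : (α → ℝ) →L[ℝ] ℝ)) x)
    (hf'' : ∀ a b, Continuous (f'' a b))
    (hC : ∀ x, |f x| ≤ C) (hC' : ∀ a x, |f' a x| ≤ C) (hC'' : ∀ a b x, |f'' a b x| ≤ C)
    (hsign : ∀ a b x, 0 ≤ (∑ m, A a m * A b m - ∑ m, B a m * B b m) * f'' a b x) :
    ∫ x, f (fun a => ∑ m, B a m * x m) ∂stdGaussianPi M
      ≤ ∫ x, f (fun a => ∑ m, A a m * x m) ∂stdGaussianPi M := by
  classical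
  have hfc : Continuous f := continuous_iff_continuousAt.2 fun x => (hf x).continuousAt
  have hf'c : ∀ a, Continuous (f' a) := fun a =>
    continuous_iff_continuousAt.2 fun x => (hf' a x).continuousAt
  -- the interpolating coefficients and their derivative
  let c : ℝ → α → M → ℝ := fun θ a m => Real.sin θ * A a m + Real.cos θ * B a m
  let d : ℝ → α → M → ℝ := fun θ a m => Real.cos θ * A a m - Real.sin θ * B a m
  let Z : ℝ → (M → ℝ) → α → ℝ := fun θ x a => ∑ m, c θ a m * x m
  let F : ℝ → (M → ℝ) → ℝ := fun θ x => f (Z θ x)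
  let F' : ℝ → (M → ℝ) → ℝ := fun θ x => ∑ a, f' a (Z θ x) * ∑ m, d θ a m * x m
  have hZc : ∀ θ, Continuous (Z θ) := fun θ => by fun_prop
  have hint : ∀ θ, Integrable (F θ) (stdGaussianPi M) := fun θ =>
    Integrable.of_bound (hfc.comp (hZc θ)).aestronglyMeasurable C
      (Eventually.of_forall fun _ => hC _)
  have hcd : ∀ θ a m, HasDerivAt (fun θ => c θ a m) (d θ a m) θ := fun θ a m =>
    (((Real.hasDerivAt_sin θ).mul_const (A a m)).add
      ((Real.hasDerivAt_cos θ).mul_const (B a m))).congr_deriv (by simp [d]; ring)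
  have hF : ∀ θ x, HasDerivAt (fun θ => F θ x) (F' θ x) θ := by
    intro θ x
    have hZ : HasDerivAt (fun θ => Z θ x) (fun a => ∑ m, d θ a m * x m) θ :=
      hasDerivAt_pi.2 fun a => HasDerivAt.fun_sum fun m _ => (hcd θ a m).mul_const (x m)
    refine ((hf (Z θ x)).comp_hasDerivAt θ hZ).congr_deriv ?_
    simp [F']
  have hd : ∀ θ a m, |d θ a m| ≤ |A a m| + |B a m| := by
    intro θ a m
    refine (abs_sub _ _).trans ?_
    rw [abs_mul, abs_mul]
    gcongr
    · exact mul_le_of_le_one_left (abs_nonneg _) (Real.abs_cos_le_one θ)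
    · exact mul_le_of_le_one_left (abs_nonneg _) (Real.abs_sin_le_one θ)
  have hderiv : ∀ θ, HasDerivAt (fun θ => ∫ x, F θ x ∂stdGaussianPi M)
      (∫ x, F' θ x ∂stdGaussianPi M) θ := by
    intro θ
    refine (hasDerivAt_integral_of_dominated_loc_of_deriv_le (F' := F') (s := Set.univ)
      (bound := fun x => ∑ a, C * ∑ m, (|A a m| + |B a m|) * |x m|)
      univ_mem ?_ (hint θ) ?_ ?_ ?_ ?_).2
    · exact Eventually.of_forall fun θ => (hint θ).aestronglyMeasurable
    · refine Continuous.aestronglyMeasurable ?_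
      have := fun a => (hf'c a).comp (hZc θ)
      simp only [F']
      fun_prop
    · refine Eventually.of_forall fun x θ _ => ?_
      refine (norm_sum_le _ _).trans (Finset.sum_le_sum fun a _ => ?_)
      rw [norm_mul]
      refine mul_le_mul (hC' a _) ?_ (norm_nonneg _) ((abs_nonneg _).trans (hC 0))
      refine (norm_sum_le _ _).trans (Finset.sum_le_sum fun m _ => ?_)
      rw [norm_mul]
      exact mul_le_mul_of_nonneg_right (hd θ a m) (norm_nonneg _)
    · refine integrable_finsetSum _ fun a _ => Integrable.const_mul
        (integrable_finsetSum _ fun m _ => Integrable.const_mul ?_ _) _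
      exact (integrable_eval_stdGaussianPi m).abs
    · exact Eventually.of_forall fun x θ _ => hF θ x
  -- integration by parts turns the derivative into a sum of covariance differences
  have hF'eq : ∀ θ, ∫ x, F' θ x ∂stdGaussianPi M
      = Real.sin θ * Real.cos θ * ∑ a, ∑ b,
        ∫ x, (∑ m, A a m * A b m - ∑ m, B a m * B b m) * f'' a b (Z θ x)
          ∂stdGaussianPi M := by
    intro θ
    have hi1 : ∀ a m, Integrable (fun x : M → ℝ => x m * f' a (Z θ x)) (stdGaussianPi M) :=
      fun a m => (integrable_eval_stdGaussianPi m).mul_bdd (c := C)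
        ((hf'c a).comp (hZc θ)).aestronglyMeasurable (Eventually.of_forall fun _ => hC' a _)
    have hi2 : ∀ a b, Integrable (fun x : M → ℝ => f'' a b (Z θ x)) (stdGaussianPi M) :=
      fun a b => Integrable.of_bound ((hf'' a b).comp (hZc θ)).aestronglyMeasurable C
        (Eventually.of_forall fun _ => hC'' a b _)
    have hstein : ∀ a m, ∫ x, x m * f' a (Z θ x) ∂stdGaussianPi M
        = ∑ b, c θ b m * ∫ x, f'' a b (Z θ x) ∂stdGaussianPi M := by
      intro a m
      have := integral_eval_mul_stdGaussianPi m
        (F := fun x => f' a (Z θ x)) (F' := fun x => ∑ b, c θ b m * f'' a b (Z θ x))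
        (C := max C (∑ b, |c θ b m| * C))
        ((hf'c a).comp (hZc θ)).measurable
        (Finset.measurable_sum _ fun b _ =>
          (((hf'' a b).comp (hZc θ)).measurable).const_mul _) ?_
        (fun x => (hC' a _).trans (le_max_left _ _)) ?_
      · rw [this, integral_finsetSum _ fun b _ => (hi2 a b).const_mul _]
        simp_rw [integral_const_mul]
      · intro x
        have hZ : HasDerivAt (fun t => Z θ (Function.update x m t)) (fun b => c θ b m) (x m) := by
          refine hasDerivAt_pi.2 fun b => ?_
          have : (fun t => Z θ (Function.update x m t) b)
              = fun t => c θ b m * t + ∑ k ∈ Finset.univ.erase m, c θ b k * x k := by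
            funext t
            simp only [Z]
            rw [← Finset.add_sum_erase _ _ (Finset.mem_univ m), Function.update_self]
            congr 1
            refine Finset.sum_congr rfl fun k hk => ?_
            rw [Function.update_of_ne (Finset.ne_of_mem_erase hk)]
          rw [this]
          simpa using ((hasDerivAt_id (x m)).const_mul (c θ b m)).add_const
            (∑ k ∈ Finset.univ.erase m, c θ b k * x k)
        have h := (hf' a (Z θ (Function.update x m (x m)))).comp_hasDerivAt (x m) hZ
        refine h.congr_deriv ?_
        simp [mul_comm]
      · intro x
        refine (Finset.abs_sum_le_sum_abs _ _).trans (le_trans ?_ (le_max_right _ _))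
        refine Finset.sum_le_sum fun b _ => ?_
        rw [abs_mul]
        exact mul_le_mul_of_nonneg_left (hC'' a b _) (abs_nonneg _)
    have hcov : ∀ a b, ∑ m, d θ a m * c θ b m = Real.sin θ * Real.cos θ *
        (∑ m, A a m * A b m - ∑ m, B a m * B b m) := by
      intro a b
      have h1 := hAB a b
      have h2 := hAB b a
      calc ∑ m, d θ a m * c θ b m
          = Real.sin θ * Real.cos θ * (∑ m, A a m * A b m - ∑ m, B a m * B b m)
            + Real.cos θ ^ 2 * ∑ m, A a m * B b m - Real.sin θ ^ 2 * ∑ m, A b m * B a m := by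
            simp only [Finset.mul_sum, ← Finset.sum_sub_distrib, ← Finset.sum_add_distrib]
            refine Finset.sum_congr rfl fun m _ => ?_
            simp only [c, d]; ring
        _ = _ := by rw [h1, h2]; ring
    calc ∫ x, F' θ x ∂stdGaussianPi M
        = ∑ a, ∑ m, d θ a m * ∫ x, x m * f' a (Z θ x) ∂stdGaussianPi M := by
          have : ∀ x, F' θ x = ∑ a, ∑ m, d θ a m * (x m * f' a (Z θ x)) := by
            intro x
            refine Finset.sum_congr rfl fun a _ => ?_
            rw [Finset.mul_sum]
            exact Finset.sum_congr rfl fun m _ => by ring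
          simp_rw [this]
          rw [integral_finsetSum _ fun a _ =>
            integrable_finsetSum _ fun m _ => (hi1 a m).const_mul _]
          refine Finset.sum_congr rfl fun a _ => ?_
          rw [integral_finsetSum _ fun m _ => (hi1 a m).const_mul _]
          simp_rw [integral_const_mul]
      _ = ∑ a, ∑ b, (∑ m, d θ a m * c θ b m) * ∫ x, f'' a b (Z θ x) ∂stdGaussianPi M := by
          refine Finset.sum_congr rfl fun a _ => ?_
          simp_rw [hstein, Finset.mul_sum, Finset.sum_mul]
          rw [Finset.sum_comm]
          exact Finset.sum_congr rfl fun b _ => Finset.sum_congr rfl fun m _ => by ring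
      _ = _ := by
          simp_rw [hcov, integral_const_mul, Finset.mul_sum, mul_assoc]
  have hmono : MonotoneOn (fun θ => ∫ x, F θ x ∂stdGaussianPi M) (Set.Icc 0 (Real.pi / 2)) := by
    refine monotoneOn_of_deriv_nonneg (convex_Icc _ _)
      (fun θ _ => (hderiv θ).continuousAt.continuousWithinAt)
      (fun θ _ => (hderiv θ).differentiableAt.differentiableWithinAt) fun θ hθ => ?_
    rw [interior_Icc] at hθ
    rw [(hderiv θ).deriv, hF'eq]
    refine mul_nonneg (mul_nonneg ?_ ?_) (Finset.sum_nonneg fun a _ => Finset.sum_nonneg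
      fun b _ => integral_nonneg fun x => hsign a b _)
    · exact Real.sin_nonneg_of_nonneg_of_le_pi hθ.1.le (by linarith [hθ.2, Real.pi_pos])
    · exact Real.cos_nonneg_of_mem_Icc ⟨by linarith [hθ.1, Real.pi_pos], hθ.2.le⟩
  have := hmono (Set.left_mem_Icc.2 (by positivity)) (Set.right_mem_Icc.2 (by positivity))
    (by positivity)
  simpa [F, Z, c] using this

/-! ### Gordon's comparison inequality -/

/-- Coordinatewise smooth approximation of the indicator of `l a < x a`, of sharpness `β`. -/
noncomputable def softStep {α : Type*} (β : ℝ) (l x : α → ℝ) : α → ℝ :=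
  fun a => Real.sigmoid (β * (x a - l a))

/-- The partial derivative of `Q ∘ softStep β l` in the coordinate `a`, written as a
function of the point `y = softStep β l x`; it uses `σ' = σ (1 - σ)` for the sigmoid `σ`. -/
noncomputable def softDeriv {α : Type*} [Fintype α] [DecidableEq α] (β : ℝ) (a : α)
    (Q : (α → ℝ) → ℝ) : (α → ℝ) → ℝ :=
  fun y => fderiv ℝ Q y (Pi.single a 1) * (β * (y a * (1 - y a)))

theorem softStep_nonneg {α : Type*} (β : ℝ) (l x : α → ℝ) (a : α) : 0 ≤ softStep β l x a :=
  Real.sigmoid_nonneg _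

theorem softStep_le_one {α : Type*} (β : ℝ) (l x : α → ℝ) (a : α) : softStep β l x a ≤ 1 :=
  Real.sigmoid_le_one _

theorem continuous_softStep {α : Type*} (β : ℝ) (l : α → ℝ) : Continuous (softStep β l) :=
  continuous_pi fun a => continuous_sigmoid.comp (by fun_prop)

theorem contDiff_softDeriv {α : Type*} [Fintype α] [DecidableEq α]
    {β : ℝ} {a : α} {Q : (α → ℝ) → ℝ} (hQ : ContDiff ℝ ⊤ Q) :
    ContDiff ℝ ⊤ (softDeriv β a Q) := by
  have h1 : ContDiff ℝ ⊤ (fderiv ℝ Q) := hQ.fderiv_right (by simp)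
  unfold softDeriv
  fun_prop

theorem hasFDerivAt_comp_softStep {α : Type*} [Fintype α] [DecidableEq α] (β : ℝ) (l : α → ℝ)
    {Q : (α → ℝ) → ℝ}
    (hQ : ContDiff ℝ ⊤ Q) (x : α → ℝ) :
    HasFDerivAt (fun x => Q (softStep β l x))
      (∑ a, softDeriv β a Q (softStep β l x) •
        (ContinuousLinearMap.proj a : (α → ℝ) →L[ℝ] ℝ)) x := by
  have hs : HasFDerivAt (softStep β l) (ContinuousLinearMap.pi fun a =>
      (β * (softStep β l x a * (1 - softStep β l x a))) •
        (ContinuousLinearMap.proj a : (α → ℝ) →L[ℝ] ℝ)) x := by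
    refine hasFDerivAt_pi.2 fun a => ?_
    have h1 : HasFDerivAt (fun x : α → ℝ => β * (x a - l a))
        (β • (ContinuousLinearMap.proj a : (α → ℝ) →L[ℝ] ℝ)) x :=
      ((ContinuousLinearMap.proj (R := ℝ) (φ := fun _ : α => ℝ) a).hasFDerivAt.sub_const
        (l a)).const_mul β
    refine ((Real.hasDerivAt_sigmoid _).comp_hasFDerivAt x h1).congr_fderiv ?_
    rw [smul_smul]
    congr 1
    simp only [softStep]
    ring
  refine (((hQ.differentiable (by simp)).differentiableAt.hasFDerivAt).comp x hs).congr_fderiv ?_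
  ext v
  simp only [ContinuousLinearMap.comp_apply, FunLike.coe_sum, Finset.sum_apply,
    _root_.smul_apply, ContinuousLinearMap.proj_apply, smul_eq_mul]
  conv_lhs => rw [pi_eq_sum_univ' (ContinuousLinearMap.pi _ v)]
  rw [map_sum]
  refine Finset.sum_congr rfl fun a _ => ?_
  rw [map_smul]
  simp only [ContinuousLinearMap.pi_apply, _root_.smul_apply, ContinuousLinearMap.proj_apply,
    smul_eq_mul, softDeriv]
  ring

theorem exists_bound_comp_softStep {α : Type*} (β : ℝ) (l : α → ℝ) {Q : (α → ℝ) → ℝ}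
    (hQ : Continuous Q) : ∃ C, ∀ x, |Q (softStep β l x)| ≤ C := by
  obtain ⟨C, hC⟩ := (isCompact_Icc (a := (0 : α → ℝ)) (b := 1)).exists_bound_of_continuousOn
    hQ.continuousOn
  exact ⟨C, fun x => hC _ ⟨softStep_nonneg β l x, softStep_le_one β l x⟩⟩

/-- For `y` with values in `{0, 1}`, the indicator that each row `i ∈ s` of `y` has a nonzero
entry, extended to all real arrays as a polynomial that is affine in each entry. -/
def rowsHit {I J : Type*} [Fintype J] (s : Finset I) (y : I × J → ℝ) : ℝ :=
  ∏ i ∈ s, (1 - ∏ j, (1 - y (i, j)))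

section RowsHit

variable {I J : Type*} [Fintype J]

theorem rowsHit_nonneg (s : Finset I) {y : I × J → ℝ} (h0 : ∀ a, 0 ≤ y a) (h1 : ∀ a, y a ≤ 1) :
    0 ≤ rowsHit s y :=
  Finset.prod_nonneg fun i _ => sub_nonneg.2 <| Finset.prod_le_one
    (fun j _ => sub_nonneg.2 (h1 _)) fun j _ => by linarith [h0 (i, j)]

theorem rowsHit_le_one (s : Finset I) {y : I × J → ℝ} (h0 : ∀ a, 0 ≤ y a) (h1 : ∀ a, y a ≤ 1) :
    rowsHit s y ≤ 1 :=
  Finset.prod_le_one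
    (fun i _ => sub_nonneg.2 <| Finset.prod_le_one
      (fun j _ => sub_nonneg.2 (h1 _)) fun j _ => by linarith [h0 (i, j)])
    fun i _ => sub_le_self _ (Finset.prod_nonneg fun j _ => sub_nonneg.2 (h1 _))

theorem rowsHit_eq_one {s : Finset I} {y : I × J → ℝ} (h : ∀ i ∈ s, ∃ j, y (i, j) = 1) :
    rowsHit s y = 1 :=
  Finset.prod_eq_one fun i hi => by
    obtain ⟨j, hj⟩ := h i hi
    rw [Finset.prod_eq_zero (Finset.mem_univ j) (by simp [hj]), sub_zero]

theorem rowsHit_eq_zero {s : Finset I} {y : I × J → ℝ} {i : I} (hi : i ∈ s)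
    (h : ∀ j, y (i, j) = 0) : rowsHit s y = 0 :=
  Finset.prod_eq_zero hi (by simp [h])

theorem contDiff_rowsHit [Fintype I] (s : Finset I) : ContDiff ℝ ⊤ (rowsHit (J := J) s) := by
  unfold rowsHit
  refine contDiff_prod fun i _ => contDiff_const.sub (contDiff_prod fun j _ => ?_)
  fun_prop

variable [DecidableEq I] [DecidableEq J]

/-- `rowsHit` is affine in each entry. -/
theorem rowsHit_add_single {s : Finset I} {i : I} (hi : i ∈ s) (j : J) (y : I × J → ℝ) (t : ℝ) :
    rowsHit s (y + t • Pi.single (i, j) 1)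
      = rowsHit s y + t * (rowsHit (s.erase i) y * ∏ k ∈ Finset.univ.erase j, (1 - y (i, k))) := by
  unfold rowsHit
  rw [← Finset.mul_prod_erase _ _ hi, ← Finset.mul_prod_erase (a := i) s _ hi]
  have h1 : ∏ i' ∈ s.erase i, (1 - ∏ k, (1 - (y + t • Pi.single (i, j) 1 : I × J → ℝ) (i', k)))
      = ∏ i' ∈ s.erase i, (1 - ∏ k, (1 - y (i', k))) := by
    refine Finset.prod_congr rfl fun i' hi' => ?_
    have : i' ≠ i := Finset.ne_of_mem_erase hi'
    simp [this]
  have h2 : ∏ k ∈ Finset.univ.erase j, (1 - (y + t • Pi.single (i, j) 1 : I × J → ℝ) (i, k))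
      = ∏ k ∈ Finset.univ.erase j, (1 - y (i, k)) := by
    refine Finset.prod_congr rfl fun k hk => ?_
    have : k ≠ j := Finset.ne_of_mem_erase hk
    simp [this]
  rw [h1, ← Finset.mul_prod_erase _ _ (Finset.mem_univ j), h2,
    ← Finset.mul_prod_erase (a := j) _ _ (Finset.mem_univ j)]
  simp
  ring

variable [Fintype I]

/-- The first derivative of the smoothed `rowsHit` in an entry of row `a.1` involves the other rows
only through `rowsHit`. -/
theorem softDeriv_rowsHit (β : ℝ) (a : I × J) :
    softDeriv β a (rowsHit Finset.univ) = fun y =>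
      rowsHit (Finset.univ.erase a.1) y * (∏ k ∈ Finset.univ.erase a.2, (1 - y (a.1, k)))
        * (β * (y a * (1 - y a))) := by
  funext y
  have h : HasLineDerivAt ℝ (rowsHit (J := J) (Finset.univ : Finset I))
      (rowsHit (Finset.univ.erase a.1) y * ∏ k ∈ Finset.univ.erase a.2, (1 - y (a.1, k))) y
      (Pi.single a 1) := by
    unfold HasLineDerivAt
    obtain ⟨i, j⟩ := a
    simp only [rowsHit_add_single (Finset.mem_univ i) j y]
    exact (((hasDerivAt_id (0 : ℝ)).mul_const _).const_add _).congr_deriv (by simp)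
  rw [softDeriv, ← (((contDiff_rowsHit (J := J) Finset.univ).differentiable
    (by simp)).differentiableAt).lineDeriv_eq_fderiv, h.lineDeriv]

/-- Mixed second derivatives of the smoothed `rowsHit` in two different rows are nonnegative. -/
theorem softDeriv_softDeriv_rowsHit_nonneg {β : ℝ} (hβ : 0 ≤ β) {a b : I × J} (hab : a.1 ≠ b.1)
    {y : I × J → ℝ} (h0 : ∀ a, 0 ≤ y a) (h1 : ∀ a, y a ≤ 1) :
    0 ≤ softDeriv β b (softDeriv β a (rowsHit Finset.univ)) y := by
  have hb : b.1 ∈ Finset.univ.erase a.1 := by simp [hab.symm]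
  have h : HasLineDerivAt ℝ (softDeriv β a (rowsHit (J := J) (Finset.univ : Finset I)))
      (rowsHit ((Finset.univ.erase a.1).erase b.1) y
        * (∏ k ∈ Finset.univ.erase b.2, (1 - y (b.1, k)))
        * (∏ k ∈ Finset.univ.erase a.2, (1 - y (a.1, k))) * (β * (y a * (1 - y a)))) y
      (Pi.single b 1) := by
    rw [softDeriv_rowsHit]
    unfold HasLineDerivAt
    have e1 : ∀ t : ℝ, ∏ k ∈ Finset.univ.erase a.2,
        (1 - (y + t • Pi.single b 1 : I × J → ℝ) (a.1, k))
        = ∏ k ∈ Finset.univ.erase a.2, (1 - y (a.1, k)) := fun t =>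
      Finset.prod_congr rfl fun k _ => by
        have : (a.1, k) ≠ b := fun h => hab (h ▸ rfl)
        simp [this]
    have e2 : ∀ t : ℝ, (y + t • Pi.single b 1 : I × J → ℝ) a = y a := fun t => by
      have : a ≠ b := fun h => hab (congrArg Prod.fst h)
      simp [this]
    have e3 : ∀ t : ℝ, _ := rowsHit_add_single hb b.2 y
    simp only [e1, e2, e3]
    exact ((((hasDerivAt_id (0 : ℝ)).mul_const _).const_add _).mul_const _).mul_const _
      |>.congr_deriv (by simp)
  rw [softDeriv, ← (((contDiff_softDeriv (contDiff_rowsHit (J := J) Finset.univ)).differentiable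
    (by simp)).differentiableAt).lineDeriv_eq_fderiv, h.lineDeriv]
  have h2 : ∀ a, 0 ≤ 1 - y a := fun a => sub_nonneg.2 (h1 a)
  have h3 := rowsHit_nonneg ((Finset.univ.erase a.1).erase b.1) h0 h1
  have h4 : 0 ≤ ∏ k ∈ Finset.univ.erase b.2, (1 - y (b.1, k)) :=
    Finset.prod_nonneg fun k _ => h2 _
  have h5 : 0 ≤ ∏ k ∈ Finset.univ.erase a.2, (1 - y (a.1, k)) :=
    Finset.prod_nonneg fun k _ => h2 _
  have := h0 a; have := h2 a; have := h0 b; have := h2 b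
  positivity

end RowsHit

/-- Gordon's comparison for the smoothed indicator that every row `i` of the array exceeds the
levels `l` at some `j`. The signs in `gaussian_interpolation` come out right because within a row
the covariances agree, and across rows the mixed derivatives are nonnegative. -/
theorem integral_rowsHit_softStep_le {I J M : Type*} [Fintype I] [Fintype J] [Fintype M]
    (A B : I × J → M → ℝ) (hAB : ∀ a b, ∑ m, A a m * B b m = 0)
    (hrow : ∀ a b, a.1 = b.1 → ∑ m, A a m * A b m = ∑ m, B a m * B b m)
    (hcov : ∀ a b, a.1 ≠ b.1 → ∑ m, B a m * B b m ≤ ∑ m, A a m * A b m)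
    {β : ℝ} (hβ : 0 ≤ β) (l : I × J → ℝ) :
    ∫ x, rowsHit Finset.univ (softStep β l fun a => ∑ m, B a m * x m) ∂stdGaussianPi M
      ≤ ∫ x, rowsHit Finset.univ (softStep β l fun a => ∑ m, A a m * x m)
        ∂stdGaussianPi M := by
  classical
  let Q : (I × J → ℝ) → ℝ := rowsHit Finset.univ
  have hQ : ContDiff ℝ ⊤ Q := contDiff_rowsHit _
  have hQ' : ∀ a, ContDiff ℝ ⊤ (softDeriv β a Q) := fun a => contDiff_softDeriv hQ
  have hQ'' : ∀ a b, ContDiff ℝ ⊤ (softDeriv β b (softDeriv β a Q)) :=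
    fun a b => contDiff_softDeriv (hQ' a)
  obtain ⟨C, hC⟩ := exists_bound_comp_softStep β l hQ.continuous
  choose C' hC' using fun a => exists_bound_comp_softStep β l (hQ' a).continuous
  choose C'' hC'' using fun a b => exists_bound_comp_softStep β l (hQ'' a b).continuous
  have hC0 : 0 ≤ C := (abs_nonneg _).trans (hC 0)
  have hC0' : ∀ a, 0 ≤ C' a := fun a => (abs_nonneg _).trans (hC' a 0)
  have hC0'' : ∀ a b, 0 ≤ C'' a b := fun a b => (abs_nonneg _).trans (hC'' a b 0)
  have hS' : ∀ a, C' a ≤ ∑ a, C' a := fun a =>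
    Finset.single_le_sum (fun a _ => hC0' a) (Finset.mem_univ a)
  have hS'' : ∀ a b, C'' a b ≤ ∑ a, ∑ b, C'' a b := fun a b =>
    (Finset.single_le_sum (fun b _ => hC0'' a b) (Finset.mem_univ b)).trans
      (Finset.single_le_sum (f := fun a => ∑ b, C'' a b)
        (fun a _ => Finset.sum_nonneg fun b _ => hC0'' a b) (Finset.mem_univ a))
  have hn' : 0 ≤ ∑ a, C' a := Finset.sum_nonneg fun a _ => hC0' a
  have hn'' : 0 ≤ ∑ a, ∑ b, C'' a b :=
    Finset.sum_nonneg fun a _ => Finset.sum_nonneg fun b _ => hC0'' a b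
  refine gaussian_interpolation A B hAB (f := fun x => Q (softStep β l x))
    (f' := fun a x => softDeriv β a Q (softStep β l x))
    (f'' := fun a b x => softDeriv β b (softDeriv β a Q) (softStep β l x))
    (C := C + ∑ a, C' a + ∑ a, ∑ b, C'' a b)
    (hasFDerivAt_comp_softStep β l hQ) (fun a => hasFDerivAt_comp_softStep β l (hQ' a))
    (fun a b => (hQ'' a b).continuous.comp (continuous_softStep β l))
    (fun x => (hC x).trans (by linarith))
    (fun a x => (hC' a x).trans (by linarith [hS' a]))
    (fun a b x => (hC'' a b x).trans (by linarith [hS'' a b])) fun a b x => ?_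
  by_cases hab : a.1 = b.1
  · simp [hrow a b hab]
  · exact mul_nonneg (sub_nonneg.2 (hcov a b hab)) (softDeriv_softDeriv_rowsHit_nonneg hβ hab
      (softStep_nonneg β l x) (softStep_le_one β l x))

/-- The pointwise limit of a sigmoid of growing sharpness; at the jump its value is `1 / 2`. -/
theorem tendsto_sigmoid_nat_mul (x : ℝ) :
    Tendsto (fun n : ℕ => Real.sigmoid (n * x)) atTop
      (𝓝 (if 0 < x then 1 else if x = 0 then 2⁻¹ else 0)) := by
  split_ifs with h1 h2
  · exact Real.tendsto_sigmoid_atTop.comp (tendsto_natCast_atTop_atTop.atTop_mul_const h1)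
  · simp [h2]
  · have : x < 0 := lt_of_le_of_ne (not_lt.1 h1) h2
    exact Real.tendsto_sigmoid_atBot.comp (tendsto_natCast_atTop_atTop.atTop_mul_const_of_neg this)

/-- Gordon's comparison inequality for two orthogonal (hence independent) Gaussian arrays that
are linear images of one standard Gaussian vector. The strict inequality on one side only absorbs
ties, which do occur when rows of `A` or `B` vanish. -/
theorem gordon_comparison {I J M : Type*} [Fintype I] [Fintype J] [Fintype M]
    (A B : I × J → M → ℝ) (hAB : ∀ a b, ∑ m, A a m * B b m = 0)
    (hrow : ∀ a b, a.1 = b.1 → ∑ m, A a m * A b m = ∑ m, B a m * B b m)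
    (hcov : ∀ a b, a.1 ≠ b.1 → ∑ m, B a m * B b m ≤ ∑ m, A a m * A b m)
    (l : I × J → ℝ) :
    stdGaussianPi M {x | ∀ i, ∃ j, l (i, j) < ∑ m, B (i, j) m * x m}
      ≤ stdGaussianPi M {x | ∀ i, ∃ j, l (i, j) ≤ ∑ m, A (i, j) m * x m} := by
  classical
  -- the limit of `softStep n l` as `n → ∞`
  let st : (I × J → ℝ) → I × J → ℝ := fun x a =>
    if 0 < x a - l a then 1 else if x a - l a = 0 then 2⁻¹ else 0
  have hst0 : ∀ x a, 0 ≤ st x a := fun x a => by simp only [st]; split_ifs <;> norm_num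
  have hst1 : ∀ x a, st x a ≤ 1 := fun x a => by simp only [st]; split_ifs <;> norm_num
  have hlim : ∀ D : I × J → M → ℝ, Tendsto (fun n : ℕ =>
      ∫ x, rowsHit Finset.univ (softStep n l fun a => ∑ m, D a m * x m) ∂stdGaussianPi M) atTop
      (𝓝 (∫ x, rowsHit Finset.univ (st fun a => ∑ m, D a m * x m) ∂stdGaussianPi M)) := by
    intro D
    refine tendsto_integral_of_dominated_convergence (fun _ => 1) (fun n => ?_)
      (integrable_const _) (fun n => Eventually.of_forall fun x => ?_)
      (Eventually.of_forall fun x => ?_)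
    · exact (((contDiff_rowsHit _).continuous.comp (continuous_softStep _ _)).comp
        (by fun_prop)).aestronglyMeasurable
    · rw [Real.norm_eq_abs, abs_of_nonneg (rowsHit_nonneg _ (softStep_nonneg _ _ _)
        (softStep_le_one _ _ _))]
      exact rowsHit_le_one _ (softStep_nonneg _ _ _) (softStep_le_one _ _ _)
    · refine ((contDiff_rowsHit (I := I) (J := J) _).continuous.tendsto _).comp ?_
      exact tendsto_pi_nhds.2 fun a => tendsto_sigmoid_nat_mul _
  have hle := le_of_tendsto_of_tendsto' (hlim B) (hlim A) fun n =>
    integral_rowsHit_softStep_le A B hAB hrow hcov (Nat.cast_nonneg n) l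
  have hmst : ∀ D : I × J → M → ℝ, Measurable fun x : M → ℝ =>
      rowsHit Finset.univ (st fun a => ∑ m, D a m * x m) := by
    intro D
    refine (contDiff_rowsHit (I := I) (J := J) _).continuous.measurable.comp
      (measurable_pi_lambda _ fun a => ?_)
    have hm : Measurable fun x : M → ℝ => ∑ m, D a m * x m - l a := by fun_prop
    exact Measurable.ite (measurableSet_lt measurable_const hm) measurable_const
      (Measurable.ite (measurableSet_eq_fun hm measurable_const) measurable_const
        measurable_const)
  have hint : ∀ D : I × J → M → ℝ, Integrable (fun x : M → ℝ =>
      rowsHit Finset.univ (st fun a => ∑ m, D a m * x m)) (stdGaussianPi M) := fun D =>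
    Integrable.of_bound (hmst D).aestronglyMeasurable 1 (Eventually.of_forall fun x => by
      rw [Real.norm_eq_abs, abs_of_nonneg (rowsHit_nonneg _ (hst0 _) (hst1 _))]
      exact rowsHit_le_one _ (hst0 _) (hst1 _))
  have hmE : ∀ D : I × J → M → ℝ,
      MeasurableSet {x : M → ℝ | ∀ i, ∃ j, l (i, j) < ∑ m, D (i, j) m * x m} := fun D => by
    simp only [Set.ofPred_forall, Set.ofPred_exists]
    exact MeasurableSet.iInter fun i => MeasurableSet.iUnion fun j =>
      measurableSet_lt measurable_const (by fun_prop)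
  have hmE' : ∀ D : I × J → M → ℝ,
      MeasurableSet {x : M → ℝ | ∀ i, ∃ j, l (i, j) ≤ ∑ m, D (i, j) m * x m} := fun D => by
    simp only [Set.ofPred_forall, Set.ofPred_exists]
    exact MeasurableSet.iInter fun i => MeasurableSet.iUnion fun j =>
      measurableSet_le measurable_const (by fun_prop)
  have h1 : (stdGaussianPi M).real {x | ∀ i, ∃ j, l (i, j) < ∑ m, B (i, j) m * x m}
      ≤ ∫ x, rowsHit Finset.univ (st fun a => ∑ m, B a m * x m) ∂stdGaussianPi M := by
    rw [← integral_indicator_one (hmE B)]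
    refine integral_mono ((integrable_const _).indicator (hmE B)) (hint B) fun x => ?_
    by_cases hx : x ∈ {x : M → ℝ | ∀ i, ∃ j, l (i, j) < ∑ m, B (i, j) m * x m}
    · rw [Set.indicator_of_mem hx]
      refine (rowsHit_eq_one fun i _ => ?_).ge
      obtain ⟨j, hj⟩ := hx i
      exact ⟨j, if_pos (sub_pos.2 hj)⟩
    · rw [Set.indicator_of_notMem hx]
      exact rowsHit_nonneg _ (hst0 _) (hst1 _)
  have h2 : ∫ x, rowsHit Finset.univ (st fun a => ∑ m, A a m * x m) ∂stdGaussianPi M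
      ≤ (stdGaussianPi M).real {x | ∀ i, ∃ j, l (i, j) ≤ ∑ m, A (i, j) m * x m} := by
    rw [← integral_indicator_one (hmE' A)]
    refine integral_mono (hint A) ((integrable_const _).indicator (hmE' A)) fun x => ?_
    by_cases hx : x ∈ {x : M → ℝ | ∀ i, ∃ j, l (i, j) ≤ ∑ m, A (i, j) m * x m}
    · rw [Set.indicator_of_mem hx]
      exact rowsHit_le_one _ (hst0 _) (hst1 _)
    · rw [Set.indicator_of_notMem hx]
      simp only [Set.mem_ofPred_eq, not_forall, not_exists, not_le] at hx
      obtain ⟨i, hi⟩ := hx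
      refine (rowsHit_eq_zero (Finset.mem_univ i) fun j => ?_).le
      have := sub_neg.2 (hi j)
      simp only [st]
      rw [if_neg this.not_gt, if_neg this.ne]
  have h3 := (h1.trans hle).trans h2
  exact (ENNReal.toReal_le_toReal (measure_ne_top _ _) (measure_ne_top _ _)).1 h3

/-! ### Families of standard Gaussian variables -/

theorem IsStdGaussianFamily.measurePreserving {Ω ι : Type*} [Fintype ι] [MeasurableSpace Ω]
    {μ : Measure Ω} [IsProbabilityMeasure μ] {X : ι → Ω → ℝ} (hX : IsStdGaussianFamily μ X) :
    MeasurePreserving (fun ω i => X i ω) μ (stdGaussianPi ι) := by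
  refine ⟨measurable_pi_lambda _ hX.1, ?_⟩
  rw [(iIndepFun_iff_map_fun_eq_pi_map fun i => (hX.1 i).aemeasurable).1 hX.2.2]
  simp [hX.2.1]

theorem IsStdGaussianFamily.precomp {Ω ι κ : Type*} [MeasurableSpace Ω]
    {μ : Measure Ω} {X : ι → Ω → ℝ} (hX : IsStdGaussianFamily μ X) {e : κ → ι}
    (he : Function.Injective e) : IsStdGaussianFamily μ (fun k => X (e k)) :=
  ⟨fun _ => hX.1 _, fun _ => hX.2.1 _, hX.2.2.precomp he⟩

theorem IsStdGaussianFamily.neg {Ω ι : Type*} [MeasurableSpace Ω]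
    {μ : Measure Ω} {X : ι → Ω → ℝ} (hX : IsStdGaussianFamily μ X) :
    IsStdGaussianFamily μ (fun i ω => - X i ω) := by
  refine ⟨fun i => (hX.1 i).neg, fun i => ?_, hX.2.2.comp (fun _ x => -x) fun _ => measurable_neg⟩
  have := Measure.map_map (μ := μ) measurable_neg (hX.1 i)
  rw [hX.2.1 i] at this
  exact this.symm.trans (by simpa using gaussianReal_map_neg (μ := 0) (v := 1))

theorem isStdGaussianFamily_eval (ι : Type*) [Fintype ι] :
    IsStdGaussianFamily (stdGaussianPi ι) (fun i x => x i) :=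
  ⟨measurable_pi_apply, fun i => (measurePreserving_eval _ i).map_eq,
    iIndepFun_pi (X := fun _ x => x) fun _ => aemeasurable_id⟩

theorem measurePreserving_comp_stdGaussianPi {ι κ : Type*} [Fintype ι] [Fintype κ] {e : κ → ι}
    (he : Function.Injective e) :
    MeasurePreserving (fun (x : ι → ℝ) k => x (e k)) (stdGaussianPi ι) (stdGaussianPi κ) :=
  ((isStdGaussianFamily_eval ι).precomp he).measurePreserving

theorem one_le_two_mul_gaussianReal_Iic : 1 ≤ 2 * gaussianReal 0 1 (Set.Iic 0) := by
  have h1 : gaussianReal 0 1 (Set.Ici 0) = gaussianReal 0 1 (Set.Iic 0) := by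
    have h := gaussianReal_map_neg (μ := 0) (v := 1)
    rw [neg_zero] at h
    conv_lhs => rw [← h]
    rw [Measure.map_apply measurable_neg measurableSet_Ici]
    congr 1
    ext x
    simp
  calc (1 : ENNReal) = gaussianReal 0 1 Set.univ := measure_univ.symm
    _ = gaussianReal 0 1 (Set.Iic 0 ∪ Set.Ici 0) := by rw [Set.Iic_union_Ici]
    _ ≤ _ := (measure_union_le _ _).trans (by rw [h1, two_mul])

/-- A coordinate on which `P` does not depend is nonpositive with probability at least `1 / 2`,
independently of `P`. -/
theorem stdGaussianPi_le_two_mul_inter_nonpos {ι : Type*} [Fintype ι] [DecidableEq ι] (m : ι)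
    {P : (ι → ℝ) → Prop} (hP : MeasurableSet {x | P x})
    (hm : ∀ x t, P (Function.update x m t) ↔ P x) :
    stdGaussianPi ι {x | P x} ≤ 2 * stdGaussianPi ι {x | P x ∧ x m ≤ 0} := by
  have hmp : MeasurePreserving (fun z : (ι → ℝ) × ℝ => Function.update z.1 m z.2)
      ((stdGaussianPi ι).prod (gaussianReal 0 1)) (stdGaussianPi ι) :=
    measurePreserving_update_pi (fun _ : ι => gaussianReal 0 1) m
  have hQ : MeasurableSet {x : ι → ℝ | P x ∧ x m ≤ 0} :=
    hP.inter (measurableSet_le (measurable_pi_apply m) measurable_const)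
  have h := hmp.measure_preimage hQ.nullMeasurableSet
  have hset : (fun z : (ι → ℝ) × ℝ => Function.update z.1 m z.2) ⁻¹' {x | P x ∧ x m ≤ 0}
      = {x | P x} ×ˢ Set.Iic 0 := by
    ext ⟨x, t⟩
    simp [hm]
  rw [← h, hset, Measure.prod_prod, mul_left_comm]
  exact le_mul_of_one_le_right zero_le one_le_two_mul_gaussianReal_Iic

/-! ### Comparison of the primary and auxiliary processes -/

/-- The matrix with entries `x`. -/
def matrixOf {n p : ℕ} (x : Fin n × Fin p → ℝ) : Matrix (Fin n) (Fin p) ℝ :=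
  Matrix.of fun i j => x (i, j)

/-- The vector of the first `n` entries of `y`. -/
def leftVec {n p : ℕ} (y : Fin n ⊕ Fin p → ℝ) : EuclideanSpace ℝ (Fin n) :=
  WithLp.toLp 2 fun i => y (Sum.inl i)

/-- The vector of the last `p` entries of `y`. -/
def rightVec {n p : ℕ} (y : Fin n ⊕ Fin p → ℝ) : EuclideanSpace ℝ (Fin p) :=
  WithLp.toLp 2 fun i => y (Sum.inr i)

theorem measurable_primaryObjective {Ω : Type*} [MeasurableSpace Ω] {n p : ℕ}
    {G : Ω → Matrix (Fin n) (Fin p) ℝ} (hG : ∀ i j, Measurable fun ω => G ω i j)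
    {ψ : Ω → EuclideanSpace ℝ (Fin p) → EuclideanSpace ℝ (Fin n) → ℝ} {w u}
    (hψ : Measurable fun ω => ψ ω w u) :
    Measurable fun ω => primaryObjective (G ω) (ψ ω) w u := by
  unfold primaryObjective
  simp only [dotProduct, mulVec]
  fun_prop

theorem measurable_auxObjective {Ω : Type*} [MeasurableSpace Ω] {n p : ℕ}
    {g : Ω → EuclideanSpace ℝ (Fin n)} {h : Ω → EuclideanSpace ℝ (Fin p)}
    (hg : Measurable g) (hh : Measurable h)
    {ψ : Ω → EuclideanSpace ℝ (Fin p) → EuclideanSpace ℝ (Fin n) → ℝ} {w u}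
    (hψ : Measurable fun ω => ψ ω w u) :
    Measurable fun ω => auxObjective (g ω) (h ω) (ψ ω) w u := by
  unfold auxObjective
  fun_prop

theorem measurable_leftVec {n p : ℕ} : Measurable (leftVec (n := n) (p := p)) := by
  unfold leftVec
  fun_prop

theorem measurable_rightVec {n p : ℕ} : Measurable (rightVec (n := n) (p := p)) := by
  unfold rightVec
  fun_prop

/-- Gordon's comparison for finitely many points. The primary process plus the independent
`‖u‖ ‖w‖ z` has the variances of the auxiliary process, and its covariances exceed those of the
auxiliary process by `(‖w‖ ‖w'‖ - ⟪w, w'⟫) (‖u‖ ‖u'‖ - ⟪u, u'⟫)`, which is nonnegative and vanishes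
for `w = w'`. The factor `2` is the price of restricting to `z ≤ 0`. -/
theorem stdGaussianPi_primary_lt_le_finite {n p : ℕ} {I J : Type*} [Fintype I] [Fintype J]
    (w : I → EuclideanSpace ℝ (Fin p)) (u : J → EuclideanSpace ℝ (Fin n))
    (ψ : EuclideanSpace ℝ (Fin p) → EuclideanSpace ℝ (Fin n) → ℝ) (t : ℝ) :
    stdGaussianPi (Fin n × Fin p)
        {x | ∃ i, ∀ j, primaryObjective (matrixOf x) ψ (w i) (u j) < t}
      ≤ 2 * stdGaussianPi (Fin n ⊕ Fin p)
        {y | ∃ i, ∀ j, auxObjective (leftVec y) (rightVec y) ψ (w i) (u j) ≤ t} := by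
  classical
  let M := ((Fin n × Fin p) ⊕ Unit) ⊕ (Fin n ⊕ Fin p)
  let A : I × J → M → ℝ := fun a => Sum.elim
    (Sum.elim (fun k => u a.2 k.1 * w a.1 k.2) fun _ => ‖u a.2‖ * ‖w a.1‖) fun _ => 0
  let B : I × J → M → ℝ := fun a => Sum.elim (fun _ => 0)
    (Sum.elim (fun k => ‖w a.1‖ * u a.2 k) fun k => ‖u a.2‖ * w a.1 k)
  let l : I × J → ℝ := fun a => t - ψ (w a.1) (u a.2)
  have hinn : ∀ {k : ℕ} (v v' : EuclideanSpace ℝ (Fin k)), ∑ m, v m * v' m = inner ℝ v v' := by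
    intro k v v'
    simp [PiLp.inner_apply, mul_comm]
  have hA : ∀ a b, ∑ m, A a m * A b m = inner ℝ (u a.2) (u b.2) * inner ℝ (w a.1) (w b.1)
      + (‖u a.2‖ * ‖w a.1‖) * (‖u b.2‖ * ‖w b.1‖) := by
    intro a b
    simp only [M, A, Fintype.sum_sum_type, Sum.elim_inl, Sum.elim_inr, mul_zero,
      Finset.sum_const_zero, add_zero, Finset.univ_unique, Finset.sum_singleton]
    rw [← hinn, ← hinn, Finset.sum_mul_sum, Fintype.sum_prod_type]
    congr 1
    exact Finset.sum_congr rfl fun i _ => Finset.sum_congr rfl fun j _ => by ring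
  have hB : ∀ a b, ∑ m, B a m * B b m = ‖w a.1‖ * ‖w b.1‖ * inner ℝ (u a.2) (u b.2)
      + ‖u a.2‖ * ‖u b.2‖ * inner ℝ (w a.1) (w b.1) := by
    intro a b
    simp only [M, B, Fintype.sum_sum_type, Sum.elim_inl, Sum.elim_inr, mul_zero,
      Finset.sum_const_zero, zero_add]
    rw [← hinn, ← hinn, Finset.mul_sum, Finset.mul_sum]
    congr 1 <;> exact Finset.sum_congr rfl fun i _ => by ring
  have hsumA : ∀ a (x : M → ℝ), ∑ m, A a m * x m + ψ (w a.1) (u a.2)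
      = primaryObjective (matrixOf fun k => x (Sum.inl (Sum.inl k))) ψ (w a.1) (u a.2)
        + ‖u a.2‖ * ‖w a.1‖ * x (Sum.inl (Sum.inr ())) := by
    intro a x
    simp only [M, A, Fintype.sum_sum_type, Sum.elim_inl, Sum.elim_inr, zero_mul,
      Finset.sum_const_zero, add_zero, Finset.univ_unique, Finset.sum_singleton,
      primaryObjective, matrixOf, dotProduct, mulVec, Matrix.of_apply, Finset.mul_sum,
      Fintype.sum_prod_type]
    have : ∀ i j, u a.2 i * w a.1 j * x (Sum.inl (Sum.inl (i, j)))
        = u a.2 i * (x (Sum.inl (Sum.inl (i, j))) * w a.1 j) := fun i j => by ring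
    simp only [this]
    exact add_right_comm _ _ _
  have hsumB : ∀ a (x : M → ℝ), ∑ m, B a m * x m + ψ (w a.1) (u a.2)
      = auxObjective (leftVec fun k => x (Sum.inr k)) (rightVec fun k => x (Sum.inr k))
        ψ (w a.1) (u a.2) := by
    intro a x
    simp only [M, B, Fintype.sum_sum_type, Sum.elim_inl, Sum.elim_inr, zero_mul,
      Finset.sum_const_zero, zero_add, auxObjective, leftVec, rightVec]
    rw [← hinn, ← hinn, Finset.mul_sum, Finset.mul_sum]
    congr 2 <;> exact Finset.sum_congr rfl fun i _ => by simp only []; ring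
  have hcmp := gordon_comparison A B
    (fun a b => by simp [M, A, B, Fintype.sum_sum_type])
    (fun a b hab => by
      rw [hA, hB, hab, real_inner_self_eq_norm_sq]; ring)
    (fun a b _ => by
      rw [hA, hB]
      have h1 := real_inner_le_norm (u a.2) (u b.2)
      have h2 := real_inner_le_norm (w a.1) (w b.1)
      nlinarith [mul_nonneg (sub_nonneg.2 h1) (sub_nonneg.2 h2)]) l
  have hmeasA : MeasurableSet {x : M → ℝ | ∃ i, ∀ j, ∑ m, A (i, j) m * x m < l (i, j)} := by
    simp only [Set.ofPred_forall, Set.ofPred_exists]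
    exact MeasurableSet.iUnion fun i => MeasurableSet.iInter fun j =>
      measurableSet_lt (by fun_prop) measurable_const
  have hmeasB : MeasurableSet {x : M → ℝ | ∃ i, ∀ j, ∑ m, B (i, j) m * x m ≤ l (i, j)} := by
    simp only [Set.ofPred_forall, Set.ofPred_exists]
    exact MeasurableSet.iUnion fun i => MeasurableSet.iInter fun j =>
      measurableSet_le (by fun_prop) measurable_const
  have hcmp' : stdGaussianPi M {x | ∃ i, ∀ j, ∑ m, A (i, j) m * x m < l (i, j)}
      ≤ stdGaussianPi M {x | ∃ i, ∀ j, ∑ m, B (i, j) m * x m ≤ l (i, j)} := by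
    have e1 : {x : M → ℝ | ∀ i, ∃ j, l (i, j) < ∑ m, B (i, j) m * x m}
        = {x : M → ℝ | ∃ i, ∀ j, ∑ m, B (i, j) m * x m ≤ l (i, j)}ᶜ := by
      ext x; simp
    have e2 : {x : M → ℝ | ∀ i, ∃ j, l (i, j) ≤ ∑ m, A (i, j) m * x m}
        = {x : M → ℝ | ∃ i, ∀ j, ∑ m, A (i, j) m * x m < l (i, j)}ᶜ := by
      ext x; simp
    rw [e1, e2, prob_compl_eq_one_sub hmeasA, prob_compl_eq_one_sub hmeasB] at hcmp
    exact (ENNReal.sub_le_sub_iff_left prob_le_one (by simp)).1 hcmp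
  have hP : MeasurableSet
      {x | ∃ i, ∀ j, primaryObjective (n := n) (p := p) (matrixOf x) ψ (w i) (u j) < t} := by
    simp only [Set.ofPred_forall, Set.ofPred_exists]
    exact MeasurableSet.iUnion fun i => MeasurableSet.iInter fun j =>
      measurableSet_lt (measurable_primaryObjective (fun a b => measurable_pi_apply (a, b))
        measurable_const) measurable_const
  have hQ : MeasurableSet
      {y | ∃ i, ∀ j, auxObjective (n := n) (p := p) (leftVec y) (rightVec y) ψ (w i) (u j)
        ≤ t} := by
    simp only [Set.ofPred_forall, Set.ofPred_exists]
    exact MeasurableSet.iUnion fun i => MeasurableSet.iInter fun j =>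
      measurableSet_le (measurable_auxObjective measurable_leftVec measurable_rightVec
        measurable_const) measurable_const
  have hmp1 : MeasurePreserving (fun (x : M → ℝ) k => x (Sum.inl (Sum.inl k)))
      (stdGaussianPi M) (stdGaussianPi (Fin n × Fin p)) :=
    measurePreserving_comp_stdGaussianPi
      (e := fun k => Sum.inl (Sum.inl k)) (Sum.inl_injective.comp Sum.inl_injective)
  have hmp2 : MeasurePreserving (fun (x : M → ℝ) k => x (Sum.inr k))
      (stdGaussianPi M) (stdGaussianPi (Fin n ⊕ Fin p)) :=
    measurePreserving_comp_stdGaussianPi (e := Sum.inr) Sum.inr_injective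
  rw [← hmp1.measure_preimage hP.nullMeasurableSet, ← hmp2.measure_preimage hQ.nullMeasurableSet]
  refine (stdGaussianPi_le_two_mul_inter_nonpos (Sum.inl (Sum.inr ()) : M)
    (P := fun x => ∃ i, ∀ j,
      primaryObjective (matrixOf fun k => x (Sum.inl (Sum.inl k))) ψ (w i) (u j) < t)
    (hmp1.measurable hP) fun x s => ?_).trans ?_
  · have : ∀ k, Function.update x (Sum.inl (Sum.inr ()) : M) s (Sum.inl (Sum.inl k))
        = x (Sum.inl (Sum.inl k)) := fun k => Function.update_of_ne (by simp) _ _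
    simp only [this]
  · gcongr 2 * ?_
    refine (measure_mono ?_).trans (hcmp'.trans (measure_mono ?_))
    · rintro x ⟨⟨i, hi⟩, hz⟩
      refine ⟨i, fun j => ?_⟩
      have h1 := hsumA (i, j) x
      have h2 : ‖u j‖ * ‖w i‖ * x (Sum.inl (Sum.inr ())) ≤ 0 :=
        mul_nonpos_of_nonneg_of_nonpos (by positivity) hz
      have h3 := hi j
      simp only [l] at h1 ⊢
      linarith
    · rintro x ⟨i, hi⟩
      refine ⟨i, fun j => ?_⟩
      have h1 := hsumB (i, j) x
      have h3 := hi j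
      simp only [l] at h1 h3 ⊢
      rw [← h1]
      linarith

/-- Gordon's comparison for two sequences of points, obtained from finitely many points by
continuity of measure. -/
theorem stdGaussianPi_primary_lt_le_seq {n p : ℕ}
    (w : ℕ → EuclideanSpace ℝ (Fin p)) (u : ℕ → EuclideanSpace ℝ (Fin n))
    (ψ : EuclideanSpace ℝ (Fin p) → EuclideanSpace ℝ (Fin n) → ℝ) (t : ℝ) :
    stdGaussianPi (Fin n × Fin p)
        {x | ∃ i, ∀ j, primaryObjective (matrixOf x) ψ (w i) (u j) < t}
      ≤ 2 * stdGaussianPi (Fin n ⊕ Fin p)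
        {y | ∃ i, ∀ j, auxObjective (leftVec y) (rightVec y) ψ (w i) (u j) ≤ t} := by
  let P : ℕ → Set (Fin n × Fin p → ℝ) := fun k =>
    {x | ∃ i < k, ∀ j, primaryObjective (matrixOf x) ψ (w i) (u j) < t}
  let Q : ℕ → ℕ → Set (Fin n ⊕ Fin p → ℝ) := fun k m =>
    {y | ∃ i < k, ∀ j < m, auxObjective (leftVec y) (rightVec y) ψ (w i) (u j) ≤ t}
  have hPmono : Monotone P := fun a b hab x ⟨i, hi, h⟩ => ⟨i, hi.trans_le hab, h⟩
  have hQanti : ∀ k, Antitone (Q k) := fun k a b hab y ⟨i, hi, h⟩ =>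
    ⟨i, hi, fun j hj => h j (hj.trans_le hab)⟩
  have hQmeas : ∀ k m, MeasurableSet (Q k m) := fun k m => by
    have : Q k m = ⋃ i, ⋃ (_ : i < k), ⋂ j, ⋂ (_ : j < m),
        {y | auxObjective (leftVec y) (rightVec y) ψ (w i) (u j) ≤ t} := by
      ext y; simp [Q]
    rw [this]
    exact MeasurableSet.iUnion fun i => MeasurableSet.iUnion fun _ => MeasurableSet.iInter fun j =>
      MeasurableSet.iInter fun _ => measurableSet_le (measurable_auxObjective measurable_leftVec
        measurable_rightVec measurable_const) measurable_const
  have hfin : ∀ k m, stdGaussianPi (Fin n × Fin p) (P k)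
      ≤ 2 * stdGaussianPi (Fin n ⊕ Fin p) (Q k m) := by
    intro k m
    refine (measure_mono ?_).trans ((stdGaussianPi_primary_lt_le_finite
      (fun i : Fin k => w i) (fun j : Fin m => u j) ψ t).trans ?_)
    · rintro x ⟨i, hi, h⟩
      exact ⟨⟨i, hi⟩, fun j => h j⟩
    · gcongr 2 * ?_
      refine measure_mono ?_
      rintro y ⟨i, h⟩
      exact ⟨i, i.2, fun j hj => h ⟨j, hj⟩⟩
  have hk : ∀ k, stdGaussianPi (Fin n × Fin p) (P k) ≤ 2 * stdGaussianPi (Fin n ⊕ Fin p)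
      {y | ∃ i, ∀ j, auxObjective (leftVec y) (rightVec y) ψ (w i) (u j) ≤ t} := by
    intro k
    have hlim := tendsto_measure_iInter_atTop (μ := stdGaussianPi (Fin n ⊕ Fin p))
      (fun m => (hQmeas k m).nullMeasurableSet) (hQanti k) ⟨0, measure_ne_top _ _⟩
    have h1 := ge_of_tendsto' (ENNReal.Tendsto.const_mul hlim (a := 2) (Or.inr (by simp)))
      (hfin k)
    refine h1.trans ?_
    gcongr 2 * ?_
    refine measure_mono fun y hy => ?_
    -- a pigeonhole: finitely many rows, so one of them works for every length `m`
    by_contra hcon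
    simp only [Set.mem_ofPred_eq, not_exists, not_forall, not_le] at hcon
    choose J hJ using hcon
    obtain ⟨i, hi, h⟩ := Set.mem_iInter.1 hy ((Finset.range k).sup J + 1)
    exact (h (J i) (Nat.lt_succ_of_le (Finset.le_sup (Finset.mem_range.2 hi)))).not_gt (hJ i)
  have hU : {x | ∃ i, ∀ j, primaryObjective (matrixOf x) ψ (w i) (u j) < t} = ⋃ k, P k := by
    ext x
    simp only [P, Set.mem_iUnion, Set.mem_ofPred_eq]
    exact ⟨fun ⟨i, h⟩ => ⟨i + 1, i, Nat.lt_succ_self i, h⟩, fun ⟨_, i, _, h⟩ => ⟨i, h⟩⟩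
  rw [hU]
  exact le_of_tendsto' (tendsto_measure_iUnion_atTop hPmono) hk

/-- Gordon's comparison for the min-max values over countable sets. -/
theorem stdGaussianPi_minMax_primary_lt_le {n p : ℕ}
    {A : Set (EuclideanSpace ℝ (Fin p))} {B : Set (EuclideanSpace ℝ (Fin n))}
    (hA : A.Countable) (hB : B.Countable)
    (ψ : EuclideanSpace ℝ (Fin p) → EuclideanSpace ℝ (Fin n) → ℝ) (t : ℝ) :
    stdGaussianPi (Fin n × Fin p)
        {x | minMax A B (primaryObjective (matrixOf x) ψ) < t}
      ≤ 2 * stdGaussianPi (Fin n ⊕ Fin p)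
        {y | minMax A B (auxObjective (leftVec y) (rightVec y) ψ) ≤ t} := by
  rcases A.eq_empty_or_nonempty with rfl | hA'
  · simp [minMax]
  rcases B.eq_empty_or_nonempty with rfl | hB'
  · have : {y | minMax A ∅ (auxObjective (n := n) (p := p) (leftVec y) (rightVec y) ψ) ≤ t}
        = Set.univ := by
      ext y
      simp only [Set.mem_ofPred_eq, Set.mem_univ, iff_true, minMax]
      obtain ⟨w, hw⟩ := hA'
      exact (iInf₂_le w hw).trans (by simp)
    rw [this, measure_univ, mul_one]
    exact prob_le_one.trans (by norm_num)
  obtain ⟨w, rfl⟩ := hA.exists_eq_range hA'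
  obtain ⟨u, rfl⟩ := hB.exists_eq_range hB'
  refine (measure_mono fun x hx => ?_).trans
    ((stdGaussianPi_primary_lt_le_seq w u ψ t).trans ?_)
  · simp only [minMax, iInf_range, iSup_range, Set.mem_ofPred_eq, iInf_lt_iff] at hx
    obtain ⟨i, hi⟩ := hx
    exact ⟨i, fun j => EReal.coe_lt_coe_iff.1 ((le_iSup (fun j => ((primaryObjective (matrixOf x) ψ
      (w i) (u j) : ℝ) : EReal)) j).trans_lt hi)⟩
  · gcongr 2 * ?_
    refine measure_mono ?_
    rintro y ⟨i, h⟩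
    simp only [minMax, iInf_range, iSup_range, Set.mem_ofPred_eq]
    exact (iInf_le _ i).trans (iSup_le fun j => EReal.coe_le_coe_iff.2 (h j))

/-! ### Min-max values over compact sets -/

/-- The min-max value of a function that is continuous on `A × B` may be computed on dense
subsets. -/
theorem minMax_eq_of_subset_closure {E F : Type*} [TopologicalSpace E] [TopologicalSpace F]
    {A DA : Set E} {B DB : Set F} {f : E → F → ℝ}
    (hf : ContinuousOn (fun x : E × F => f x.1 x.2) (A ×ˢ B)) (hB : IsCompact B)
    (hDA : DA ⊆ A) (hA : A ⊆ closure DA) (hDB : DB ⊆ B) (hB' : B ⊆ closure DB) :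
    minMax A B f = minMax DA DB f := by
  have hsup : ∀ w ∈ A, ⨆ u ∈ DB, (f w u : EReal) = ⨆ u ∈ B, (f w u : EReal) := by
    intro w hw
    refine le_antisymm (biSup_mono hDB) (iSup₂_le fun u hu => ?_)
    have hfw : ContinuousWithinAt (fun u => f w u) DB u :=
      ((hf (w, u) ⟨hw, hu⟩).comp (f := fun u => (w, u)) (by fun_prop)
        fun u hu => ⟨hw, hu⟩).mono hDB
    have : (𝓝[DB] u).NeBot := mem_closure_iff_nhdsWithin_neBot.1 (hB' hu)
    refine le_of_tendsto ((continuous_coe_real_ereal.tendsto _).comp hfw) ?_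
    filter_upwards [self_mem_nhdsWithin] with v hv
    exact le_iSup₂ (f := fun v _ => (f w v : EReal)) v hv
  have h1 : minMax DA DB f = ⨅ w ∈ DA, ⨆ u ∈ B, (f w u : EReal) :=
    iInf_congr fun w => iInf_congr fun hw => hsup w (hDA hw)
  rw [h1]
  refine le_antisymm (biInf_mono hDA)
    (le_iInf₂ fun w hw => le_of_forall_gt_imp_ge_of_dense fun c hc => ?_)
  -- by compactness of `B`, the bound `sup_u f w u < c` persists for `w'` near `w`
  have hev : ∀ᶠ w' in 𝓝 w, ∀ u ∈ B, w' ∈ A → (u ∈ B → (f w' u : EReal) < c) := by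
    refine hB.eventually_forall_of_forall_eventually (P := fun w' u => w' ∈ A →
      (u ∈ B → (f w' u : EReal) < c)) fun u hu => ?_
    have hlt : (f w u : EReal) < c := (le_iSup₂ (f := fun u _ => (f w u : EReal)) u hu).trans_lt hc
    have := (continuous_coe_real_ereal.continuousAt.comp_continuousWithinAt
      (hf (w, u) ⟨hw, hu⟩)).eventually_lt_const hlt
    rw [eventually_nhdsWithin_iff] at this
    filter_upwards [this] with z hz h1 h2 using hz ⟨h1, h2⟩
  obtain ⟨w', hw', h⟩ := (mem_closure_iff_frequently.1 (hA hw)).and_eventually hev |>.exists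
  exact (iInf₂_le w' hw').trans (iSup₂_le fun u hu => (h u hu (hDA hw') hu).le)

theorem measurable_minMax {Ω E F : Type*} [MeasurableSpace Ω] {A : Set E} {B : Set F}
    (hA : A.Countable) (hB : B.Countable) {f : Ω → E → F → ℝ}
    (hf : ∀ w u, Measurable fun ω => f ω w u) : Measurable fun ω => minMax A B (f ω) :=
  Measurable.biInf A hA fun w _ => Measurable.biSup B hB fun u _ => (hf w u).coe_real_ereal

theorem exists_countable_subset_closure {E : Type*} [PseudoMetricSpace E]
    [TopologicalSpace.SeparableSpace E] (A : Set E) :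
    ∃ D ⊆ A, D.Countable ∧ A ⊆ closure D :=
  (TopologicalSpace.IsSeparable.of_separableSpace A).exists_countable_dense_subset

section Objectives

variable {n p : ℕ} {A : Set (EuclideanSpace ℝ (Fin p))} {B : Set (EuclideanSpace ℝ (Fin n))}
  {ψ : EuclideanSpace ℝ (Fin p) → EuclideanSpace ℝ (Fin n) → ℝ}

theorem continuousOn_primaryObjective (G : Matrix (Fin n) (Fin p) ℝ)
    (hψ : ContinuousOn (fun x : _ × _ => ψ x.1 x.2) (A ×ˢ B)) :
    ContinuousOn (fun x : _ × _ => primaryObjective G ψ x.1 x.2) (A ×ˢ B) := by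
  unfold primaryObjective
  refine ContinuousOn.add (Continuous.continuousOn ?_) hψ
  simp only [dotProduct, mulVec]
  fun_prop

theorem continuousOn_auxObjective (g : EuclideanSpace ℝ (Fin n)) (h : EuclideanSpace ℝ (Fin p))
    (hψ : ContinuousOn (fun x : _ × _ => ψ x.1 x.2) (A ×ˢ B)) :
    ContinuousOn (fun x : _ × _ => auxObjective g h ψ x.1 x.2) (A ×ˢ B) := by
  unfold auxObjective
  exact ContinuousOn.add (Continuous.continuousOn (by fun_prop)) hψ

theorem primaryObjective_neg_transpose (G : Matrix (Fin n) (Fin p) ℝ)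
    (w : EuclideanSpace ℝ (Fin p)) (u : EuclideanSpace ℝ (Fin n)) :
    primaryObjective (-Gᵀ) (fun u w => -ψ w u) u w = -primaryObjective G ψ w u := by
  unfold primaryObjective
  rw [neg_mulVec, dotProduct_neg, mulVec_transpose, dotProduct_comm, ← dotProduct_mulVec]
  ring

theorem auxObjective_neg_swap (g : EuclideanSpace ℝ (Fin n)) (h : EuclideanSpace ℝ (Fin p))
    (w : EuclideanSpace ℝ (Fin p)) (u : EuclideanSpace ℝ (Fin n)) :
    auxObjective (-h) (-g) (fun u w => -ψ w u) u w = -auxObjective g h ψ w u := by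
  unfold auxObjective
  rw [inner_neg_left, inner_neg_left]
  ring

theorem convexOn_primaryObjective (G : Matrix (Fin n) (Fin p) ℝ) (hA : Convex ℝ A)
    {u : EuclideanSpace ℝ (Fin n)} (hψ : ConvexOn ℝ A fun w => ψ w u) :
    ConvexOn ℝ A fun w => primaryObjective G ψ w u := by
  refine ConvexOn.add ⟨hA, fun x _ y _ a b _ _ _ => le_of_eq ?_⟩ hψ
  simp only [WithLp.ofLp_add, WithLp.ofLp_smul, mulVec_add, mulVec_smul, dotProduct_add,
    dotProduct_smul]

theorem concaveOn_primaryObjective (G : Matrix (Fin n) (Fin p) ℝ) (hB : Convex ℝ B)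
    {w : EuclideanSpace ℝ (Fin p)} (hψ : ConcaveOn ℝ B fun u => ψ w u) :
    ConcaveOn ℝ B fun u => primaryObjective G ψ w u := by
  refine ConcaveOn.add ⟨hB, fun x _ y _ a b _ _ _ => le_of_eq ?_⟩ hψ
  simp only [WithLp.ofLp_add, WithLp.ofLp_smul, add_dotProduct, smul_dotProduct]

end Objectives

/-- Exchanging the players and the sign turns a max-min value into a min-max value. -/
theorem minMax_neg_swap_lt {E F : Type*} {A : Set E} {B : Set F} {f : E → F → ℝ} {t : ℝ}
    (h : (t : EReal) < ⨆ u ∈ B, ⨅ w ∈ A, (f w u : EReal)) :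
    minMax B A (fun u w => -f w u) < ((-t : ℝ) : EReal) := by
  simp only [lt_iSup_iff] at h
  obtain ⟨u, hu, h⟩ := h
  rw [EReal.coe_neg]
  refine (iInf₂_le u hu).trans_lt (lt_of_le_of_lt (iSup₂_le fun w hw => ?_)
    (EReal.neg_lt_neg_iff.2 h))
  rw [EReal.coe_neg]
  exact EReal.neg_le_neg_iff.2 (iInf₂_le w hw)

/-- The weak duality `max min ≤ min max`, with the max-min value written as the min-max value of the
game with players exchanged and signs reversed. -/
theorem le_minMax_of_minMax_neg_swap_le {E F : Type*} {A : Set E} {B : Set F} {f : E → F → ℝ}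
    {t : ℝ} (h : minMax B A (fun u w => -f w u) ≤ ((-t : ℝ) : EReal)) :
    (t : EReal) ≤ minMax A B f := by
  refine le_iInf₂ fun w hw => ?_
  rw [EReal.coe_neg] at h
  refine EReal.neg_le_neg_iff.1 (le_trans (le_iInf₂ fun u hu => ?_) h)
  refine le_trans ?_ (le_iSup₂ (f := fun w _ => ((-f w u : ℝ) : EReal)) w hw)
  rw [EReal.coe_neg]
  exact EReal.neg_le_neg_iff.2 (le_iSup₂ (f := fun u _ => (f w u : EReal)) u hu)

/-! ### The convex Gaussian min-max theorem for a fixed function -/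

section Comparison

variable {Ω : Type*} [MeasurableSpace Ω] {μ : Measure Ω} [IsProbabilityMeasure μ] {n p : ℕ}
  {A : Set (EuclideanSpace ℝ (Fin p))} {B : Set (EuclideanSpace ℝ (Fin n))}
  {ψ : EuclideanSpace ℝ (Fin p) → EuclideanSpace ℝ (Fin n) → ℝ}
  {G : Ω → Matrix (Fin n) (Fin p) ℝ}
  {g : Ω → EuclideanSpace ℝ (Fin n)} {h : Ω → EuclideanSpace ℝ (Fin p)}

/-- Lower tail of the primary value against that of the auxiliary one; no convexity is needed. -/
theorem measure_minMax_primary_lt_le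
    (hG : IsStdGaussianFamily μ fun (ij : Fin n × Fin p) ω => G ω ij.1 ij.2)
    (hgh : IsStdGaussianFamily μ
      (Sum.elim (fun i ω => g ω i) (fun j ω => h ω j) : Fin n ⊕ Fin p → Ω → ℝ))
    (hB : IsCompact B) (hψ : ContinuousOn (fun x : _ × _ => ψ x.1 x.2) (A ×ˢ B)) (t : ℝ) :
    μ {ω | minMax A B (primaryObjective (G ω) ψ) < t}
      ≤ 2 * μ {ω | minMax A B (auxObjective (g ω) (h ω) ψ) ≤ t} := by
  obtain ⟨DA, hDA, hDAc, hA'⟩ := exists_countable_subset_closure A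
  obtain ⟨DB, hDB, hDBc, hB'⟩ := exists_countable_subset_closure B
  simp only [minMax_eq_of_subset_closure (continuousOn_primaryObjective _ hψ) hB hDA hA' hDB hB',
    minMax_eq_of_subset_closure (continuousOn_auxObjective _ _ hψ) hB hDA hA' hDB hB']
  have h1 : MeasurableSet
      {x | minMax DA DB (primaryObjective (n := n) (p := p) (matrixOf x) ψ) < t} :=
    measurableSet_lt (measurable_minMax hDAc hDBc fun w u => measurable_primaryObjective
      (fun i j => measurable_pi_apply (i, j)) measurable_const) measurable_const
  have h2 : MeasurableSet
      {y | minMax DA DB (auxObjective (n := n) (p := p) (leftVec y) (rightVec y) ψ) ≤ t} :=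
    measurableSet_le (measurable_minMax hDAc hDBc fun w u => measurable_auxObjective
      measurable_leftVec measurable_rightVec measurable_const) measurable_const
  have h3 := stdGaussianPi_minMax_primary_lt_le hDAc hDBc ψ t
  rw [← hG.measurePreserving.measure_preimage h1.nullMeasurableSet,
    ← hgh.measurePreserving.measure_preimage h2.nullMeasurableSet] at h3
  exact h3

/-- Upper tail of the primary value against that of the auxiliary one. By Sion's minimax theorem
the primary value is a max-min, so this is the lower tail bound for the problem with the roles of
`w` and `u` exchanged and all signs reversed. -/
theorem measure_lt_minMax_primary_le
    (hG : IsStdGaussianFamily μ fun (ij : Fin n × Fin p) ω => G ω ij.1 ij.2)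
    (hgh : IsStdGaussianFamily μ
      (Sum.elim (fun i ω => g ω i) (fun j ω => h ω j) : Fin n ⊕ Fin p → Ω → ℝ))
    (hA : IsCompact A) (hA' : Convex ℝ A) (hB' : Convex ℝ B)
    (hψ : ContinuousOn (fun x : _ × _ => ψ x.1 x.2) (A ×ˢ B))
    (hψ_convex : ∀ u ∈ B, ConvexOn ℝ A fun w => ψ w u)
    (hψ_concave : ∀ w ∈ A, ConcaveOn ℝ B fun u => ψ w u) (t : ℝ) :
    μ {ω | t < minMax A B (primaryObjective (G ω) ψ)}
      ≤ 2 * μ {ω | t ≤ minMax A B (auxObjective (g ω) (h ω) ψ)} := by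
  rcases A.eq_empty_or_nonempty with rfl | hAne
  · have : {ω | (t : EReal) ≤ minMax ∅ B (auxObjective (g ω) (h ω) ψ)} = Set.univ := by
      ext ω; simp [minMax]
    rw [this, measure_univ, mul_one]
    exact prob_le_one.trans (by norm_num)
  have hG' : IsStdGaussianFamily μ fun (ji : Fin p × Fin n) ω => (-(G ω)ᵀ) ji.1 ji.2 :=
    (hG.precomp Prod.swap_injective).neg
  have hgh' : IsStdGaussianFamily μ (Sum.elim (fun j ω => (-h ω) j) (fun i ω => (-g ω) i) :
      Fin p ⊕ Fin n → Ω → ℝ) := by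
    convert (hgh.precomp (e := Sum.swap) (Equiv.sumComm _ _).injective).neg using 1
    funext k ω
    rcases k with k | k <;> simp
  have hψ' : ContinuousOn (fun x : _ × _ => (fun u w => -ψ w u) x.1 x.2) (B ×ˢ A) :=
    (hψ.comp continuous_swap.continuousOn fun x hx => ⟨hx.2, hx.1⟩).neg
  refine (measure_mono fun ω hω => ?_).trans
    ((measure_minMax_primary_lt_le (ψ := fun u w => -ψ w u) hG' hgh' hA hψ' (-t)).trans ?_)
  · have hc := continuousOn_primaryObjective (G ω) hψ
    have hsion := Sion.minimax' (f := fun w u => (primaryObjective (G ω) ψ w u : EReal))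
      (X := A) (Y := B) hAne hA' hA
      (fun u hu => (continuous_coe_real_ereal.comp_continuousOn
        (hc.comp (f := fun w => (w, u)) (by fun_prop)
          fun w hw => ⟨hw, hu⟩)).lowerSemicontinuousOn)
      (fun u hu => ?_) hB'
      (fun w hw => (continuous_coe_real_ereal.comp_continuousOn
        (hc.comp (f := fun u => (w, u)) (by fun_prop)
          fun u hu => ⟨hw, hu⟩)).upperSemicontinuousOn)
      (fun w hw => ?_)
    · rw [Set.mem_ofPred_eq, minMax, hsion] at hω
      have := minMax_neg_swap_lt hω
      simpa only [Set.mem_ofPred_eq, minMax, primaryObjective_neg_transpose] using this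
    · exact (convexOn_primaryObjective (G ω) hA' (hψ_convex u hu)).quasiconvexOn.monotone_comp
        (g := Real.toEReal) EReal.coe_strictMono.monotone
    · exact (concaveOn_primaryObjective (G ω) hB' (hψ_concave w hw)).quasiconcaveOn.monotone_comp
        (g := Real.toEReal) EReal.coe_strictMono.monotone
  · gcongr 2 * ?_
    refine measure_mono fun ω hω => le_minMax_of_minMax_neg_swap_le ?_
    simpa only [Set.mem_ofPred_eq, minMax, auxObjective_neg_swap] using hω

end Comparison

/-! ### Conditional Borel-Cantelli arguments -/

/-- Converse Borel-Cantelli lemma in contrapositive form. -/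
theorem tsum_measure_ne_top_of_ae_eventually_notMem {Ω : Type*} [MeasurableSpace Ω]
    {μ : Measure Ω} [IsProbabilityMeasure μ] {s : ℕ → Set Ω} (hsm : ∀ n, MeasurableSet (s n))
    (hs : iIndepSet s μ) (h : ∀ᵐ ω ∂μ, ∀ᶠ n in atTop, ω ∉ s n) : ∑' n, μ (s n) ≠ ⊤ := by
  intro htop
  have h1 := measure_limsup_eq_one hsm hs htop
  have h0 : μ (limsup s atTop) = 0 := by
    refine measure_mono_null (fun ω hω => ?_) (ae_iff.1 h)
    rw [mem_limsup_iff_frequently_mem] at hω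
    simpa [Filter.Frequently] using hω
  rw [h0] at h1
  exact zero_ne_one h1

/-- A property of two independent random variables that holds almost surely still holds when the
second variable is replaced by an independent copy, realized on a second factor `Ω`. -/
theorem ae_ae_of_indepFun {Ω 𝒳 𝒴 : Type*} [MeasurableSpace Ω] [MeasurableSpace 𝒳]
    [MeasurableSpace 𝒴] {μ : Measure Ω} [IsProbabilityMeasure μ] {X : Ω → 𝒳} {Y : Ω → 𝒴}
    (hX : Measurable X) (hY : Measurable Y) (hXY : IndepFun X Y μ) {S : Set (𝒳 × 𝒴)}
    (hS : MeasurableSet S) (h : ∀ᵐ ω ∂μ, (X ω, Y ω) ∈ S) :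
    ∀ᵐ ω ∂μ, ∀ᵐ ω' ∂μ, (X ω, Y ω') ∈ S := by
  have hlaw : μ.map (fun ω => (X ω, Y ω)) = (μ.prod μ).map (Prod.map X Y) := by
    rw [(indepFun_iff_map_prod_eq_prod_map_map hX.aemeasurable hY.aemeasurable).1 hXY,
      Measure.map_prod_map μ μ hX hY]
  have h1 : ∀ᵐ z ∂μ.map (fun ω => (X ω, Y ω)), z ∈ S :=
    (ae_map_iff (hX.prodMk hY).aemeasurable hS).2 h
  rw [hlaw] at h1
  exact Measure.ae_ae_of_ae_prod ((ae_map_iff (hX.prodMap hY).aemeasurable hS).1 h1)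

/-- First Borel-Cantelli lemma conditionally on `X`: if for almost every value of `X` the
conditional probabilities of the events `(X, Z n) ∈ W n` are summable, then almost surely only
finitely many of the events occur. No joint independence of the `Z n` is needed. -/
theorem ae_eventually_notMem_of_indepFun {Ω 𝒳 : Type*} {𝒵 : ℕ → Type*} [MeasurableSpace Ω]
    [MeasurableSpace 𝒳] [∀ n, MeasurableSpace (𝒵 n)] {μ : Measure Ω} [IsProbabilityMeasure μ]
    {X : Ω → 𝒳} {Z : ∀ n, Ω → 𝒵 n} (hX : Measurable X) (hZ : ∀ n, Measurable (Z n))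
    (hXZ : ∀ n, IndepFun X (Z n) μ) {W : ∀ n, Set (𝒳 × 𝒵 n)} (hW : ∀ n, MeasurableSet (W n))
    (h : ∀ᵐ ω ∂μ, ∑' n, μ {ω' | (X ω, Z n ω') ∈ W n} ≠ ⊤) :
    ∀ᵐ ω ∂μ, ∀ᶠ n in atTop, (X ω, Z n ω) ∉ W n := by
  have : ∀ n, IsProbabilityMeasure (μ.map (Z n)) := fun n =>
    Measure.isProbabilityMeasure_map (hZ n).aemeasurable
  have : IsProbabilityMeasure (μ.map X) := Measure.isProbabilityMeasure_map hX.aemeasurable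
  let F : 𝒳 → ENNReal := fun x => ∑' n, μ.map (Z n) (Prod.mk x ⁻¹' W n)
  have hFn : ∀ n, Measurable fun x => μ.map (Z n) (Prod.mk x ⁻¹' W n) := fun n =>
    measurable_measure_prodMk_left (hW n)
  have hF : Measurable F := Measurable.tsum hFn
  have hFX : ∀ ω, F (X ω) = ∑' n, μ {ω' | (X ω, Z n ω') ∈ W n} := fun ω => by
    refine tsum_congr fun n => ?_
    rw [Measure.map_apply (hZ n) (measurable_prodMk_left (hW n))]
    rfl
  -- truncate to the event that the conditional sum is at most `K`
  have hK : ∀ K : ℕ, ∀ᵐ ω ∂μ, ∀ᶠ n in atTop, ω ∉ {ω | F (X ω) ≤ K ∧ (X ω, Z n ω) ∈ W n} := by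
    intro K
    have hE : MeasurableSet {x | F x ≤ K} := measurableSet_le hF measurable_const
    refine ae_eventually_notMem (ne_top_of_le_ne_top (ENNReal.natCast_ne_top K) ?_)
    have hterm : ∀ n, μ {ω | F (X ω) ≤ K ∧ (X ω, Z n ω) ∈ W n}
        = ∫⁻ x, {x | F x ≤ K}.indicator (fun x => μ.map (Z n) (Prod.mk x ⁻¹' W n)) x
          ∂μ.map X := by
      intro n
      have hm : MeasurableSet ({x | F x ≤ K} ×ˢ Set.univ ∩ W n : Set (𝒳 × 𝒵 n)) :=
        (hE.prod MeasurableSet.univ).inter (hW n)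
      have hlaw := (indepFun_iff_map_prod_eq_prod_map_map hX.aemeasurable
        (hZ n).aemeasurable).1 (hXZ n)
      calc μ {ω | F (X ω) ≤ K ∧ (X ω, Z n ω) ∈ W n}
          = μ.map (fun ω => (X ω, Z n ω)) ({x | F x ≤ K} ×ˢ Set.univ ∩ W n) := by
            rw [Measure.map_apply (hX.prodMk (hZ n)) hm]
            congr 1
            ext ω
            simp
        _ = _ := by
            rw [hlaw, Measure.prod_apply hm]
            refine lintegral_congr fun x => ?_
            by_cases hx : F x ≤ K
            · rw [Set.indicator_of_mem (show x ∈ {x | F x ≤ K} from hx)]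
              congr 1
              ext z
              simp [hx]
            · rw [Set.indicator_of_notMem (show x ∉ {x | F x ≤ K} from hx)]
              refine (congrArg _ ?_).trans measure_empty
              ext z
              simp [hx]
    simp_rw [hterm]
    rw [← lintegral_tsum fun n => ((hFn n).indicator hE).aemeasurable]
    calc ∫⁻ x, ∑' n, {x | F x ≤ K}.indicator (fun x => μ.map (Z n) (Prod.mk x ⁻¹' W n)) x
          ∂μ.map X ≤ ∫⁻ _, K ∂μ.map X := by
          refine lintegral_mono fun x => ?_
          by_cases hx : F x ≤ K
          · simpa [Set.indicator_of_mem (show x ∈ {x | F x ≤ K} from hx)] using hx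
          · simp [Set.indicator_of_notMem (show x ∉ {x | F x ≤ K} from hx)]
      _ = K := by simp
  filter_upwards [ae_all_iff.2 hK, h] with ω hω hfin
  rw [← hFX] at hfin
  obtain ⟨K, hKle⟩ := ENNReal.exists_nat_gt hfin
  filter_upwards [hω K] with n hn hmem
  exact hn ⟨hKle.le, hmem⟩

/-- Transfer of almost sure statements between two sequences of random variables that are each
independent of `X`, from a comparison of conditional probabilities given `X`. Given `X`, the
events `(X n, Y n) ∈ V n` are independent, so their conditional probabilities are summable by the
converse Borel-Cantelli lemma, and the direct lemma applies to `(X n, Z n) ∈ W n`. -/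
theorem ae_eventually_notMem_of_measure_le_two_mul {Ω : Type*} {𝒳 𝒴 𝒵 : ℕ → Type*}
    [MeasurableSpace Ω] [∀ n, MeasurableSpace (𝒳 n)] [∀ n, MeasurableSpace (𝒴 n)]
    [∀ n, MeasurableSpace (𝒵 n)] {μ : Measure Ω} [IsProbabilityMeasure μ]
    {X : ∀ n, Ω → 𝒳 n} {Y : ∀ n, Ω → 𝒴 n} {Z : ∀ n, Ω → 𝒵 n}
    (hX : ∀ n, Measurable (X n)) (hY : ∀ n, Measurable (Y n)) (hZ : ∀ n, Measurable (Z n))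
    (hYi : iIndepFun Y μ) (hYX : IndepFun (fun ω n => Y n ω) (fun ω n => X n ω) μ)
    (hZX : ∀ n, IndepFun (Z n) (fun ω m => X m ω) μ)
    {V : ∀ n, Set (𝒳 n × 𝒴 n)} (hV : ∀ n, MeasurableSet (V n))
    {W : ∀ n, Set (𝒳 n × 𝒵 n)} (hW : ∀ n, MeasurableSet (W n))
    (hVW : ∀ n ω, μ {ω' | (X n ω, Z n ω') ∈ W n} ≤ 2 * μ {ω' | (X n ω, Y n ω') ∈ V n})
    (h : ∀ᵐ ω ∂μ, ∀ᶠ n in atTop, (X n ω, Y n ω) ∉ V n) :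
    ∀ᵐ ω ∂μ, ∀ᶠ n in atTop, (X n ω, Z n ω) ∉ W n := by
  have hXm : Measurable fun ω n => X n ω := measurable_pi_lambda _ hX
  have hYm : Measurable fun ω n => Y n ω := measurable_pi_lambda _ hY
  have hS : MeasurableSet {z : (∀ n, 𝒳 n) × (∀ n, 𝒴 n) | ∀ᶠ n in atTop, (z.1 n, z.2 n) ∉ V n} := by
    simp only [eventually_atTop, Set.ofPred_exists, Set.ofPred_forall]
    refine MeasurableSet.iUnion fun a => MeasurableSet.iInter fun n => MeasurableSet.iInter fun _ =>
      MeasurableSet.compl (s := {z : (∀ n, 𝒳 n) × (∀ n, 𝒴 n) | (z.1 n, z.2 n) ∈ V n}) ?_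
    exact (((measurable_pi_apply n).comp measurable_fst).prodMk
      ((measurable_pi_apply n).comp measurable_snd)) (hV n)
  have h1 := ae_ae_of_indepFun hXm hYm hYX.symm hS h
  refine ae_eventually_notMem_of_indepFun (X := fun ω m => X m ω) (Z := Z)
    (W := fun n => {z | (z.1 n, z.2) ∈ W n}) hXm hZ (fun n => (hZX n).symm)
    (fun n => (((measurable_pi_apply n).comp measurable_fst).prodMk measurable_snd) (hW n)) ?_
  filter_upwards [h1] with ω hω
  have hsm : ∀ n, MeasurableSet {y | (X n ω, y) ∈ V n} := fun n => measurable_prodMk_left (hV n)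
  have h2 : ∑' n, μ {ω' | (X n ω, Y n ω') ∈ V n} ≠ ⊤ := by
    refine tsum_measure_ne_top_of_ae_eventually_notMem (fun n => hY n (hsm n)) ?_ hω
    refine (iIndepSet_iff_meas_biInter fun n => hY n (hsm n)).2 fun s => ?_
    exact hYi.measure_inter_preimage_eq_mul s fun n _ => hsm n
  refine ne_top_of_le_ne_top (ENNReal.mul_ne_top (by simp : (2 : ENNReal) ≠ ⊤) h2) ?_
  rw [← ENNReal.tsum_mul_left]
  exact ENNReal.tsum_le_tsum fun n => hVW n ω

/-! ### Localization of the primary minimizers -/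

theorem mainTheorem6
    {Ω : Type*} [MeasurableSpace Ω] (μ : Measure Ω) [IsProbabilityMeasure μ]
    (p : ℕ → ℕ)
    -- feasible sets
    (Sw : ∀ n, Set (EuclideanSpace ℝ (Fin (p n))))
    (Su : ∀ n, Set (EuclideanSpace ℝ (Fin n)))
    (hSw : ∀ n, IsCompact (Sw n)) (hSw_conv : ∀ n, Convex ℝ (Sw n))
    (hSu : ∀ n, IsCompact (Su n)) (hSu_conv : ∀ n, Convex ℝ (Su n))
    -- the random functions `ψ⁽ⁿ⁾`, continuous and convex-concave
    (ψ : ∀ n, Ω → EuclideanSpace ℝ (Fin (p n)) → EuclideanSpace ℝ (Fin n) → ℝ)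
    (hψ_meas : ∀ n w u, Measurable fun ω => ψ n ω w u)
    (hψ_cont : ∀ n ω, ContinuousOn
      (fun x : EuclideanSpace ℝ (Fin (p n)) × EuclideanSpace ℝ (Fin n) => ψ n ω x.1 x.2)
      (Sw n ×ˢ Su n))
    (hψ_convex : ∀ n ω, ∀ u ∈ Su n, ConvexOn ℝ (Sw n) fun w => ψ n ω w u)
    (hψ_concave : ∀ n ω, ∀ w ∈ Sw n, ConcaveOn ℝ (Su n) fun u => ψ n ω w u)
    -- the Gaussian matrices of the primary problems, independent of the `ψ`'s
    (G : ∀ n, Ω → Matrix (Fin n) (Fin (p n)) ℝ)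
    (hG : ∀ n, IsStdGaussianFamily μ fun (ij : Fin n × Fin (p n)) ω => G n ω ij.1 ij.2)
    (hGψ : ∀ n, IndepFun (fun ω (ij : Fin n × Fin (p n)) => G n ω ij.1 ij.2)
      (fun ω m => ψ m ω) μ)
    -- the Gaussian vectors of the auxiliary problems: `g⁽ⁿ⁾` and `h⁽ⁿ⁾` are independent,
    -- the pairs are independent across `n`, and their sequence is independent of the `ψ`'s
    (g : ∀ n, Ω → EuclideanSpace ℝ (Fin n))
    (h : ∀ n, Ω → EuclideanSpace ℝ (Fin (p n)))
    (hgh : ∀ n, IsStdGaussianFamily μ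
      (Sum.elim (fun i ω => g n ω i) (fun j ω => h n ω j) : Fin n ⊕ Fin (p n) → Ω → ℝ))
    (hgh_indep : iIndepFun (fun n ω => (g n ω, h n ω)) μ)
    (hghψ : IndepFun (fun ω n => (g n ω, h n ω)) (fun ω n => ψ n ω) μ)
    -- `S⁽ⁿ⁾` is a relatively open subset of the feasible set
    (S : ∀ n, Set (EuclideanSpace ℝ (Fin (p n))))
    (hS : ∀ n, ∃ O : Set (EuclideanSpace ℝ (Fin (p n))), IsOpen O ∧ S n = Sw n ∩ O)
    -- almost sure limits of the auxiliary optimal costs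
    (φbar φbarSc : ℝ)
    (hφ : ∀ᵐ ω ∂μ, Tendsto
      (fun n => minMax (Sw n) (Su n) (auxObjective (g n ω) (h n ω) (ψ n ω)))
      atTop (𝓝 (φbar : EReal)))
    (hφSc : ∀ᵐ ω ∂μ, Tendsto
      (fun n => minMax (Sw n \ S n) (Su n) (auxObjective (g n ω) (h n ω) (ψ n ω)))
      atTop (𝓝 (φbarSc : EReal)))
    (hlt : φbar < φbarSc) :
    ∀ᵐ ω ∂μ, ∀ᶠ n in atTop, ∀ w,
      IsMinMaxMinimizer (Sw n) (Su n) (primaryObjective (G n ω) (ψ n ω)) w → w ∈ S n := by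
  have hSc : ∀ n, IsCompact (Sw n \ S n) := fun n => by
    obtain ⟨O, hO, hSO⟩ := hS n
    rw [hSO, Set.sdiff_self_inter]
    exact (hSw n).diff hO
  -- Countable dense subsets make the min-max values jointly measurable in the random data.
  choose DA hDA hDAc hDA' using fun n => exists_countable_subset_closure (Sw n)
  choose DB hDB hDBc hDB' using fun n => exists_countable_subset_closure (Su n)
  choose DC hDC hDCc hDC' using fun n => exists_countable_subset_closure (Sw n \ S n)
  have hψ_cont' : ∀ n ω, ContinuousOn
      (fun x : EuclideanSpace ℝ (Fin (p n)) × EuclideanSpace ℝ (Fin n) => ψ n ω x.1 x.2)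
      ((Sw n \ S n) ×ˢ Su n) := fun n ω =>
    (hψ_cont n ω).mono (Set.prod_mono Set.sdiff_subset subset_rfl)
  have ePA : ∀ n ω G, minMax (DA n) (DB n) (primaryObjective G (ψ n ω))
      = minMax (Sw n) (Su n) (primaryObjective G (ψ n ω)) := fun n ω G =>
    (minMax_eq_of_subset_closure (continuousOn_primaryObjective G (hψ_cont n ω)) (hSu n)
      (hDA n) (hDA' n) (hDB n) (hDB' n)).symm
  have eAA : ∀ n ω g h, minMax (DA n) (DB n) (auxObjective g h (ψ n ω))
      = minMax (Sw n) (Su n) (auxObjective g h (ψ n ω)) := fun n ω g h =>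
    (minMax_eq_of_subset_closure (continuousOn_auxObjective g h (hψ_cont n ω)) (hSu n)
      (hDA n) (hDA' n) (hDB n) (hDB' n)).symm
  have ePC : ∀ n ω G, minMax (DC n) (DB n) (primaryObjective G (ψ n ω))
      = minMax (Sw n \ S n) (Su n) (primaryObjective G (ψ n ω)) := fun n ω G =>
    (minMax_eq_of_subset_closure (continuousOn_primaryObjective G (hψ_cont' n ω)) (hSu n)
      (hDC n) (hDC' n) (hDB n) (hDB' n)).symm
  have eAC : ∀ n ω g h, minMax (DC n) (DB n) (auxObjective g h (ψ n ω))
      = minMax (Sw n \ S n) (Su n) (auxObjective g h (ψ n ω)) := fun n ω g h =>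
    (minMax_eq_of_subset_closure (continuousOn_auxObjective g h (hψ_cont' n ω)) (hSu n)
      (hDC n) (hDC' n) (hDB n) (hDB' n)).symm
  have hψm : ∀ n, Measurable (ψ n) := fun n =>
    measurable_pi_lambda _ fun w => measurable_pi_lambda _ fun u => hψ_meas n w u
  have hgm : ∀ n, Measurable (g n) := fun n =>
    (PiLp.continuous_toLp 2 _).measurable.comp
      (measurable_pi_lambda _ fun i => (hgh n).1 (Sum.inl i))
  have hhm : ∀ n, Measurable (h n) := fun n =>
    (PiLp.continuous_toLp 2 _).measurable.comp
      (measurable_pi_lambda _ fun i => (hgh n).1 (Sum.inr i))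
  have hGm : ∀ n, Measurable fun ω (ij : Fin n × Fin (p n)) => G n ω ij.1 ij.2 := fun n =>
    measurable_pi_lambda _ (hG n).1
  have mP : ∀ n (D : Set _) (D' : Set _), D.Countable → D'.Countable → Measurable
      fun z : (EuclideanSpace ℝ (Fin (p n)) → EuclideanSpace ℝ (Fin n) → ℝ)
        × (Fin n × Fin (p n) → ℝ) => minMax D D' (primaryObjective (matrixOf z.2) z.1) := by
    intro n D D' hD hD'
    exact measurable_minMax hD hD' fun w u => measurable_primaryObjective
      (fun i j => (measurable_pi_apply (i, j)).comp measurable_snd)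
      ((measurable_pi_apply u).comp ((measurable_pi_apply w).comp measurable_fst))
  have mA : ∀ n (D : Set _) (D' : Set _), D.Countable → D'.Countable → Measurable
      fun z : (EuclideanSpace ℝ (Fin (p n)) → EuclideanSpace ℝ (Fin n) → ℝ)
        × (EuclideanSpace ℝ (Fin n) × EuclideanSpace ℝ (Fin (p n))) =>
        minMax D D' (auxObjective z.2.1 z.2.2 z.1) := by
    intro n D D' hD hD'
    exact measurable_minMax hD hD' fun w u => measurable_auxObjective
      (measurable_fst.comp measurable_snd) (measurable_snd.comp measurable_snd)
      ((measurable_pi_apply u).comp ((measurable_pi_apply w).comp measurable_fst))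
  -- Eventually the primary value is at most `c₁`, while its value outside `S n` is at least `c₂`.
  obtain ⟨c₁, hc₁, hc₁'⟩ := exists_between hlt
  obtain ⟨c₂, hc₂, hc₂'⟩ := exists_between hc₁'
  have hupper := ae_eventually_notMem_of_measure_le_two_mul
    (Z := fun n ω (ij : Fin n × Fin (p n)) => G n ω ij.1 ij.2)
    (V := fun n => {z | (c₁ : EReal) ≤ minMax (DA n) (DB n) (auxObjective z.2.1 z.2.2 z.1)})
    (W := fun n => {z | (c₁ : EReal) < minMax (DA n) (DB n)
      (primaryObjective (matrixOf z.2) z.1)})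
    hψm (fun n => (hgm n).prodMk (hhm n)) hGm hgh_indep hghψ hGψ
    (fun n => measurableSet_le measurable_const (mA n _ _ (hDAc n) (hDBc n)))
    (fun n => measurableSet_lt measurable_const (mP n _ _ (hDAc n) (hDBc n)))
    (fun n ω => by
      simp only [Set.mem_ofPred_eq, ePA, eAA]
      exact measure_lt_minMax_primary_le (hG n) (hgh n) (hSw n) (hSw_conv n) (hSu_conv n)
        (hψ_cont n ω) (hψ_convex n ω) (hψ_concave n ω) c₁)
    (by
      filter_upwards [hφ] with ω hω
      simp only [eAA, not_le]
      exact hω.eventually_lt_const (EReal.coe_lt_coe_iff.2 hc₁))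
  have hlower := ae_eventually_notMem_of_measure_le_two_mul
    (Z := fun n ω (ij : Fin n × Fin (p n)) => G n ω ij.1 ij.2)
    (V := fun n => {z | minMax (DC n) (DB n) (auxObjective z.2.1 z.2.2 z.1) ≤ (c₂ : EReal)})
    (W := fun n => {z | minMax (DC n) (DB n)
      (primaryObjective (matrixOf z.2) z.1) < (c₂ : EReal)})
    hψm (fun n => (hgm n).prodMk (hhm n)) hGm hgh_indep hghψ hGψ
    (fun n => measurableSet_le (mA n _ _ (hDCc n) (hDBc n)) measurable_const)
    (fun n => measurableSet_lt (mP n _ _ (hDCc n) (hDBc n)) measurable_const)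
    (fun n ω => by
      simp only [Set.mem_ofPred_eq, ePC, eAC]
      exact measure_minMax_primary_lt_le (hG n) (hgh n) (hSu n) (hψ_cont' n ω) c₂)
    (by
      filter_upwards [hφSc] with ω hω
      simp only [eAC, not_le]
      exact hω.eventually_const_lt (EReal.coe_lt_coe_iff.2 hc₂'))
  filter_upwards [hupper, hlower] with ω hω₁ hω₂
  filter_upwards [hω₁, hω₂] with n hn₁ hn₂ w hw
  simp only [ePA, not_lt] at hn₁
  simp only [ePC, not_lt] at hn₂
  by_contra hwS
  have hle : minMax (Sw n \ S n) (Su n) (primaryObjective (G n ω) (ψ n ω))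
      ≤ minMax (Sw n) (Su n) (primaryObjective (G n ω) (ψ n ω)) :=
    (iInf₂_le w ⟨hw.1, hwS⟩).trans (le_iInf₂ hw.2)
  have : (c₂ : EReal) ≤ c₁ := (hn₂.trans hle).trans hn₁
  exact (EReal.coe_le_coe_iff.1 this).not_gt hc₂
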